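/- Let $(X,\mu)$ be an atomless standard probability space and let $\mathrm{Aut}(X,\mu)$ be the group of measure-preserving Borel bijections of $X$, two bijections being identified when they agree outside a $\mu$-null set. Let $\mathbb G\le \mathrm{Aut}(X,\mu)$ be an ergodic full group, that is, a subgroup such that: (i) (full) whenever $(A_n)_{n\in\mathbb N}$ is a measurable partition of $X$ up to null sets (with possibly empty pieces) and $(T_n)_{n\in\mathbb N}$ is a sequence in $\mathbb G$ such that $(T_n(A_n))_{n\in\mathbb N}$ is also a partition of $X$ up to null sets, the element $T\in\mathrm{Aut}(X,\mu)$ given by $T(x)=T_n(x)$ for almost every $x\in A_n$ and all $n$ belongs to $\mathbb G$; (ii) (ergodic) every measurable $A\subseteq X$ with $\mu(T(A)\,\triangle\, A)=0$ for all $T\in\mathbb G$ satisfies $\mu(A)\in\{0,1\}$. Let $\tau$ be a Hausdorff group topology on $\mathbb G$ which is SIN, that is, the identity element has a basis of $\tau$-neighborhoods which are invariant under conjugation by elements of $\mathbb G$. Then $\tau$ is either the discrete topology or the uniform topology, the latter being the topology induced by the metric $d_u(S,T)=\mu(\{x\in X: S(x)\neq T(x)\})$. -/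

import Mathlib

open MeasureTheory Filter Topology

namespace PMP

section Basic

variable {X : Type*} [MeasurableSpace X]

/-- Measure-preserving bijections of `(X, μ)`, before identification modulo null sets. -/
def Bij (μ : Measure X) : Type _ := {T : X ≃ᵐ X // MeasurePreserving T μ μ}

instance (μ : Measure X) : CoeFun (Bij μ) (fun _ => X → X) := ⟨fun T => T.1⟩

/-- The group structure is composition: `(S * T) x = S (T x)`. -/
instance (μ : Measure X) : Group (Bij μ) where
  mul S T := ⟨T.1.trans S.1, S.2.comp T.2⟩
  one := ⟨MeasurableEquiv.refl X, MeasurePreserving.id μ⟩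
  inv T := ⟨T.1.symm, T.2.symm T.1⟩
  mul_assoc _ _ _ := rfl
  one_mul _ := rfl
  mul_one _ := rfl
  inv_mul_cancel T := Subtype.ext (MeasurableEquiv.ext (funext fun x => T.1.symm_apply_apply x))

theorem Bij.mul_apply {μ : Measure X} (S T : Bij μ) (x : X) : (S * T) x = S (T x) := rfl

theorem Bij.one_apply {μ : Measure X} (x : X) : (1 : Bij μ) x = x := rfl

theorem Bij.inv_apply {μ : Measure X} (T : Bij μ) (x : X) : (T⁻¹) x = T.1.symm x := rfl

/-- Almost everywhere equality, as a congruence on the group of measure-preserving bijections. -/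
def aeCon (μ : Measure X) : Con (Bij μ) where
  r S T := ∀ᵐ x ∂μ, S x = T x
  iseqv :=
    { refl := fun _ => Eventually.of_forall fun _ => rfl
      symm := fun h => h.mono fun _ hx => hx.symm
      trans := fun h h' => by filter_upwards [h, h'] with x hx hx' using hx.trans hx' }
  mul' := by
    intro S S' T T' h h'
    filter_upwards [h', T.2.quasiMeasurePreserving.ae h] with x hx hx'
    rw [Bij.mul_apply, Bij.mul_apply, ← hx]
    exact hx'

/-- `Aut(X, μ)`: measure-preserving bijections up to equality almost everywhere. -/
abbrev Aut (μ : Measure X) : Type _ := (aeCon μ).Quotient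

/-- The class in `Aut(X, μ)` of a measure-preserving bijection. -/
def Aut.mk {μ : Measure X} (T : Bij μ) : Aut μ := (T : (aeCon μ).Quotient)

theorem Aut.mk_eq_mk {μ : Measure X} {S T : Bij μ} :
    Aut.mk S = Aut.mk T ↔ ∀ᵐ x ∂μ, S x = T x := (aeCon μ).eq

theorem Aut.mk_surjective {μ : Measure X} : Function.Surjective (Aut.mk : Bij μ → Aut μ) :=
  Quotient.mk_surjective

/-- A countable measurable partition of `X` up to null sets (pieces may be empty). -/
structure IsPartition (μ : Measure X) (A : ℕ → Set X) : Prop where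
  measurableSet : ∀ n, MeasurableSet (A n)
  disjoint : ∀ m n, m ≠ n → μ (A m ∩ A n) = 0
  cover : μ (⋃ n, A n)ᶜ = 0

/-- Full groups: subgroups of `Aut(X, μ)` stable under countable cutting and pasting. -/
def IsFull {μ : Measure X} (G : Subgroup (Aut μ)) : Prop :=
  ∀ (A : ℕ → Set X) (T : ℕ → Bij μ),
    (∀ n, Aut.mk (T n) ∈ G) → IsPartition μ A → IsPartition μ (fun n => T n '' A n) →
    ∀ S : Bij μ, (∀ n, ∀ᵐ x ∂μ, x ∈ A n → S x = T n x) → Aut.mk S ∈ G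

/-- Ergodicity: up to null sets, the only `G`-invariant measurable sets are `∅` and `X`. -/
def IsErgodic {μ : Measure X} (G : Subgroup (Aut μ)) : Prop :=
  ∀ A : Set X, MeasurableSet A →
    (∀ T : Bij μ, Aut.mk T ∈ G → T '' A =ᵐ[μ] A) →
    A =ᵐ[μ] (∅ : Set X) ∨ A =ᵐ[μ] (Set.univ : Set X)

/-- The uniform metric `d_u(S, T) = μ {x | S x ≠ T x}` on `Aut(X, μ)`. -/
noncomputable def uniformDist {μ : Measure X} (S T : Aut μ) : ℝ :=
  Quotient.liftOn₂ S T (fun S T : Bij μ => μ.real {x | S x ≠ T x}) (by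
    intro S T S' T' h h'
    refine measureReal_congr ?_
    have h1 : ∀ᵐ x ∂μ, S x = S' x := h
    have h2 : ∀ᵐ x ∂μ, T x = T' x := h'
    filter_upwards [h1, h2] with x hx hx'
    refine propext ?_
    change (S x ≠ T x) ↔ (S' x ≠ T' x)
    rw [hx, hx'])

theorem uniformDist_mk {μ : Measure X} (S T : Bij μ) :
    uniformDist (Aut.mk S) (Aut.mk T) = μ.real {x | S x ≠ T x} := rfl

/-- `Aut(X, μ)` as a metric space for the uniform metric. -/
noncomputable abbrev uniformMetric (μ : Measure X) [IsFiniteMeasure μ] : MetricSpace (Aut μ) where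
  dist := uniformDist
  dist_self S := by
    obtain ⟨S, rfl⟩ := Aut.mk_surjective S
    simp [uniformDist_mk]
  dist_comm S T := by
    obtain ⟨S, rfl⟩ := Aut.mk_surjective S
    obtain ⟨T, rfl⟩ := Aut.mk_surjective T
    simp only [uniformDist_mk, ne_comm]
  dist_triangle S T U := by
    obtain ⟨S, rfl⟩ := Aut.mk_surjective S
    obtain ⟨T, rfl⟩ := Aut.mk_surjective T
    obtain ⟨U, rfl⟩ := Aut.mk_surjective U
    simp only [uniformDist_mk]
    refine le_trans (measureReal_mono ?_) (measureReal_union_le _ _)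
    intro x hx
    by_contra hc
    simp only [Set.mem_union, Set.mem_ofPred_eq, not_or, not_not] at hc
    exact hx (hc.1.trans hc.2)
  eq_of_dist_eq_zero := by
    intro S T h
    obtain ⟨S, rfl⟩ := Aut.mk_surjective S
    obtain ⟨T, rfl⟩ := Aut.mk_surjective T
    rw [Aut.mk_eq_mk]
    exact (measureReal_eq_zero_iff).1 h

/-- The uniform topology on a subgroup of `Aut(X, μ)`. -/
noncomputable abbrev uniformTopology {μ : Measure X} [IsFiniteMeasure μ] (G : Subgroup (Aut μ)) :
    TopologicalSpace G :=
  TopologicalSpace.induced Subtype.val (uniformMetric μ).toUniformSpace.toTopologicalSpace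

end Basic

/-- SIN (small invariant neighborhoods): the conjugation-invariant neighborhoods of the identity
form a basis of neighborhoods of the identity. -/
def IsSIN (G : Type*) [Group G] [TopologicalSpace G] : Prop :=
  (𝓝 (1 : G)).HasBasis
    (fun V : Set G => V ∈ 𝓝 (1 : G) ∧ ∀ g : G, ∀ v ∈ V, g * v * g⁻¹ ∈ V) id

end PMP

/-! The engine is a commutator trick. Let V be conjugation-invariant and contain some T ≠ 1. There
is a set A, disjoint from T(A), with at least a third of the measure of supp T. If U is an
involution in the group supported in A, then T U T⁻¹ U⁻¹ is a product of two involutions with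
disjoint supports, hence an involution with support of measure 2μ(supp U). It is also T (U T U⁻¹)⁻¹,
an element of V V⁻¹. In an ergodic full group, involutions with supports of equal measure are
conjugate, so V V⁻¹ contains every involution with support of measure at most (2/3)μ(supp T):
`exists_eq_div_of_conj_invariant`.

If some uniform ball were not a τ-neighborhood of 1, every such neighborhood V would contain a T
with support of measure at least ε, and one fixed nontrivial involution would lie in all
neighborhoods of 1, against Hausdorffness (`uniform_ball_mem_nhds_one`). If τ is not discrete, every
V contains some T ≠ 1, so V V⁻¹ contains all small enough involutions; since an element of small
support is a product of six small involutions (`exists_eq_prod_involutions`), every neighborhood of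
1 contains a uniform ball (`exists_uniform_ball_subset`).

The six involutions come from a telescoping: with T₀ = T, write Tₙ = Uₙ Kₙ Tₙ₊₁ Kₙ, where Uₙ and Kₙ
are involutions and the Tₙ live on disjoint sets whose measures shrink by 2/3. The infinite products
Sᵢ = Tᵢ Tᵢ₊₂ Tᵢ₊₄ ⋯ satisfy S₀ = T S₂, so T = (S₀ S₁⁻¹)(S₁ S₂⁻¹), and each factor is a product of
three involutions. -/

namespace PMP

/-! ### Cutting and pasting -/

section Glue

variable {X : Type*} [MeasurableSpace X] {μ : Measure X}

theorem Bij.ext {S T : Bij μ} (h : ∀ x, S x = T x) : S = T :=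
  Subtype.ext (MeasurableEquiv.ext (funext h))

theorem Bij.inv_apply_self (T : Bij μ) (x : X) : (T⁻¹) (T x) = x := T.1.symm_apply_apply x

theorem Bij.apply_inv_self (T : Bij μ) (x : X) : T ((T⁻¹) x) = x := T.1.apply_symm_apply x

theorem Bij.injective (T : Bij μ) : Function.Injective T := T.1.injective

theorem Bij.measurable (T : Bij μ) : Measurable T := T.1.measurable

theorem Bij.ae (T : Bij μ) {p : X → Prop} (h : ∀ᵐ x ∂μ, p x) : ∀ᵐ x ∂μ, p (T x) :=
  T.2.quasiMeasurePreserving.ae h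

theorem Bij.measure_preimage (T : Bij μ) (A : Set X) : μ (T ⁻¹' A) = μ A :=
  T.2.measure_preimage_equiv A

theorem Bij.measureReal_preimage (T : Bij μ) (A : Set X) : μ.real (T ⁻¹' A) = μ.real A := by
  simp only [Measure.real, T.measure_preimage]

theorem Bij.image_eq (T : Bij μ) (A : Set X) : T '' A = (T⁻¹ : Bij μ) ⁻¹' A := by
  ext y
  constructor
  · rintro ⟨x, hx, rfl⟩
    simpa [Bij.inv_apply_self] using hx
  · intro hy
    exact ⟨_, hy, T.apply_inv_self y⟩

theorem Bij.measurableSet_image (T : Bij μ) {A : Set X} (hA : MeasurableSet A) :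
    MeasurableSet (T '' A) := by
  rw [Bij.image_eq]; exact (T⁻¹ : Bij μ).measurable hA

/-- The measure-preserving bijections whose class belongs to `G`. -/
def lift (G : Subgroup (Aut μ)) : Subgroup (Bij μ) := G.comap (aeCon μ).mk'

theorem mem_lift {G : Subgroup (Aut μ)} {T : Bij μ} : T ∈ lift G ↔ Aut.mk T ∈ G := Iff.rfl

/-- A bijection obtained from a countable family by cutting and pasting. -/
theorem exists_bij_glue {ι : Type*} [Countable ι] (A : ι → Set X) (T : ι → Bij μ)
    (hA : ∀ i, MeasurableSet (A i)) (h1 : ∀ x, ∃! i, x ∈ A i)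
    (h2 : ∀ y, ∃! i, ((T i)⁻¹) y ∈ A i) :
    ∃ S : Bij μ, ∀ i, ∀ x ∈ A i, S x = T i x := by
  -- `f x` is the index of the piece containing `x`, and `g y` that of the image piece containing
  -- `y`.
  choose f hf hfu using h1
  choose g hg hgu using h2
  have hpre : ∀ (F : ι → X → X) (k : X → ι) (B : ι → Set X), (∀ i x, x ∈ B i ↔ k x = i) →
      ∀ s, (fun x => F (k x) x) ⁻¹' s = ⋃ i, (B i ∩ F i ⁻¹' s) := by
    intro F k B hB s
    ext x
    simp only [Set.mem_preimage, Set.mem_iUnion, Set.mem_inter_iff, hB]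
    constructor
    · intro h; exact ⟨_, rfl, h⟩
    · rintro ⟨i, rfl, h⟩; exact h
  have hfA : ∀ i x, x ∈ A i ↔ f x = i :=
    fun i x => ⟨fun h => (hfu x i h).symm, fun h => h ▸ hf x⟩
  have hgA : ∀ i y, y ∈ ((T i)⁻¹ : Bij μ) ⁻¹' A i ↔ g y = i :=
    fun i x => ⟨fun h => (hgu x i h).symm, fun h => h ▸ hg x⟩
  have hS : Measurable (fun x => T (f x) x) := by
    intro s hs
    rw [hpre (fun i x => T i x) f A hfA]
    exact .iUnion fun i => (hA i).inter ((T i).measurable hs)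
  have hS' : Measurable (fun y => ((T (g y))⁻¹) y) := by
    intro s hs
    rw [hpre (fun i x => ((T i)⁻¹) x) g _ hgA]
    exact .iUnion fun i => ((T i)⁻¹.measurable (hA i)).inter ((T i)⁻¹.measurable hs)
  have hgf : ∀ x, g (T (f x) x) = f x := fun x => by
    rw [← hgA, Set.mem_preimage, Bij.inv_apply_self]; exact hf x
  have hfg : ∀ y, f (((T (g y))⁻¹) y) = g y := fun y => by
    rw [← hfA]; exact hg y
  let e : X ≃ᵐ X :=
    { toFun := fun x => T (f x) x
      invFun := fun y => ((T (g y))⁻¹) y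
      left_inv := fun x => by simp only [hgf, Bij.inv_apply_self]
      right_inv := fun y => by simp only [hfg, Bij.apply_inv_self]
      measurable_toFun := hS
      measurable_invFun := hS' }
  refine ⟨⟨e, ⟨hS, ?_⟩⟩, fun i x hx => ?_⟩
  · ext s hs
    have hm : ∀ i, MeasurableSet (A i ∩ T i ⁻¹' s) := fun i => (hA i).inter ((T i).measurable hs)
    have hm' : ∀ i, MeasurableSet (((T i)⁻¹ : Bij μ) ⁻¹' A i ∩ s) :=
      fun i => ((T i)⁻¹.measurable (hA i)).inter hs
    refine (Measure.map_apply hS hs).trans ?_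
    have hs2 : s = ⋃ i, (((T i)⁻¹ : Bij μ) ⁻¹' A i ∩ s) := by
      ext y
      simp only [Set.mem_iUnion, Set.mem_inter_iff]
      exact ⟨fun h => ⟨g y, hg y, h⟩, fun ⟨_, _, h⟩ => h⟩
    rw [hpre (fun i x => T i x) f A hfA, measure_iUnion _ hm]
    · conv_rhs => rw [hs2]
      rw [measure_iUnion _ hm']
      · refine tsum_congr fun i => ?_
        rw [← (T i).measure_preimage (_ ∩ s)]
        congr 1
        ext x
        simp [Bij.inv_apply_self]
      · intro i j hij
        refine Set.disjoint_left.2 fun y hy hy' => hij ?_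
        rw [← (hgA i y).1 hy.1, ← (hgA j y).1 hy'.1]
    · intro i j hij
      refine Set.disjoint_left.2 fun y hy hy' => hij ?_
      rw [← (hfA i y).1 hy.1, ← (hfA j y).1 hy'.1]
  · change T (f x) x = T i x
    rw [(hfA i x).1 hx]

theorem mem_lift_of_glue {G : Subgroup (Aut μ)} (hfull : IsFull G) {ι : Type*} [Countable ι]
    (A : ι → Set X) (T : ι → Bij μ) (hA : ∀ i, MeasurableSet (A i)) (hT : ∀ i, T i ∈ lift G)
    (h1 : ∀ x, ∃! i, x ∈ A i) (h2 : ∀ y, ∃! i, ((T i)⁻¹) y ∈ A i) {S : Bij μ}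
    (hS : ∀ i, ∀ x ∈ A i, S x = T i x) : S ∈ lift G := by
  classical
  let _ := Encodable.ofCountable ι
  -- Fullness concerns families indexed by `ℕ`. Under `decode₂` each index has exactly one code;
  -- every other integer gets the empty piece and the identity.
  let A' : ℕ → Set X := fun n => ⋃ i ∈ Encodable.decode₂ ι n, A i
  let T' : ℕ → Bij μ := fun n => (Encodable.decode₂ ι n).elim 1 T
  have hA'T : ∀ n x, x ∈ A' n → ∃ i, Encodable.encode i = n ∧ x ∈ A i ∧ T' n = T i := by
    intro n x hx
    obtain ⟨i, hi, hx⟩ := Set.mem_iUnion₂.1 hx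
    refine ⟨i, Encodable.mem_decode₂.1 hi, hx, ?_⟩
    simp only [T', Option.mem_def.1 hi, Option.elim]
  have hA' : ∀ i x, x ∈ A i → x ∈ A' (Encodable.encode i) ∧ T' (Encodable.encode i) = T i := by
    intro i x hx
    refine ⟨Set.mem_iUnion₂.2 ⟨i, Encodable.mem_decode₂.2 rfl, hx⟩, ?_⟩
    simp [T']
  have hmeas : ∀ n, MeasurableSet (A' n) := fun n =>
    .iUnion fun i => .iUnion fun _ => hA i
  refine hfull A' T' (fun n => ?_) ⟨hmeas, ?_, ?_⟩
    ⟨fun n => (T' n).measurableSet_image (hmeas n), ?_, ?_⟩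
    S fun n => ?_
  · rw [← mem_lift]
    simp only [T']
    cases Encodable.decode₂ ι n with
    | none => exact one_mem _
    | some i => exact hT i
  · intro m n hmn
    convert measure_empty (μ := μ)
    ext x
    simp only [Set.mem_inter_iff, Set.mem_empty_iff_false, iff_false]
    rintro ⟨h, h'⟩
    obtain ⟨i, rfl, hi, -⟩ := hA'T m x h
    obtain ⟨j, rfl, hj, -⟩ := hA'T n x h'
    exact hmn (congrArg _ ((h1 x).unique hi hj))
  · convert measure_empty (μ := μ)
    ext x
    obtain ⟨i, hi, -⟩ := h1 x
    simp only [Set.mem_compl_iff, Set.mem_iUnion, Set.mem_empty_iff_false, iff_false, not_not]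
    exact ⟨_, (hA' i x hi).1⟩
  · intro m n hmn
    convert measure_empty (μ := μ)
    ext y
    simp only [Set.mem_inter_iff, Set.mem_empty_iff_false, iff_false]
    rintro ⟨⟨x, h, rfl⟩, ⟨x', h', he⟩⟩
    obtain ⟨i, rfl, hi, hTi⟩ := hA'T m x h
    obtain ⟨j, rfl, hj, hTj⟩ := hA'T n x' h'
    rw [hTi] at he
    rw [hTj] at he
    refine hmn (congrArg _ ((h2 (T i x)).unique ?_ ?_))
    · rwa [Bij.inv_apply_self]
    · rwa [← he, Bij.inv_apply_self]
  · convert measure_empty (μ := μ)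
    ext y
    obtain ⟨i, hi, -⟩ := h2 y
    simp only [Set.mem_compl_iff, Set.mem_iUnion, Set.mem_empty_iff_false, iff_false, not_not]
    obtain ⟨h, h'⟩ := hA' i _ hi
    refine ⟨_, _, h, ?_⟩
    rw [h', Bij.apply_inv_self]
  · refine Eventually.of_forall fun x hx => ?_
    obtain ⟨i, rfl, hi, hTi⟩ := hA'T n x hx
    rw [hTi, hS i x hi]

theorem exists_glue {G : Subgroup (Aut μ)} (hfull : IsFull G) {ι : Type*} [Countable ι]
    (A : ι → Set X) (T : ι → Bij μ) (hA : ∀ i, MeasurableSet (A i)) (hT : ∀ i, T i ∈ lift G)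
    (h1 : ∀ x, ∃! i, x ∈ A i) (h2 : ∀ y, ∃! i, ((T i)⁻¹) y ∈ A i) :
    ∃ S ∈ lift G, ∀ i, ∀ x ∈ A i, S x = T i x := by
  obtain ⟨S, hS⟩ := exists_bij_glue A T hA h1 h2
  exact ⟨S, mem_lift_of_glue hfull A T hA hT h1 h2 hS, hS⟩

/-- A null set is contained in an invariant null set of a countable family. -/
theorem exists_null_invariant {ι : Type*} [Countable ι] (T : ι → Bij μ) {N : Set X}
    (hN : μ N = 0) :
    ∃ M, N ⊆ M ∧ MeasurableSet M ∧ μ M = 0 ∧ ∀ i x, T i x ∈ M ↔ x ∈ M := by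
  -- Saturate a measurable null hull of `N` by iterating preimages under all `T i` and their
  -- inverses.
  let F : Set X → Set X := fun A => A ∪ ⋃ i, (T i ⁻¹' A ∪ ((T i)⁻¹ : Bij μ) ⁻¹' A)
  let M : ℕ → Set X := fun n => F^[n] (toMeasurable μ N)
  have hM : ∀ n, M (n + 1) = F (M n) := fun n => Function.iterate_succ_apply' F n _
  refine ⟨⋃ n, M n, ?_, .iUnion fun n => ?_, measure_iUnion_null fun n => ?_, fun i x => ?_⟩
  · exact (subset_toMeasurable μ N).trans (Set.subset_iUnion M 0)
  · induction n with
    | zero => exact measurableSet_toMeasurable μ N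
    | succ n ih =>
      rw [hM]
      exact ih.union (.iUnion fun i => ((T i).measurable ih).union ((T i)⁻¹.measurable ih))
  · induction n with
    | zero => exact (measure_toMeasurable N).trans hN
    | succ n ih =>
      rw [hM]
      refine measure_union_null ih (measure_iUnion_null fun i => measure_union_null ?_ ?_)
      · rw [Bij.measure_preimage, ih]
      · rw [Bij.measure_preimage, ih]
  · simp only [Set.mem_iUnion]
    constructor
    · rintro ⟨n, hn⟩
      refine ⟨n + 1, ?_⟩
      rw [hM]
      exact Or.inr (Set.mem_iUnion.2 ⟨i, Or.inl hn⟩)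
    · rintro ⟨n, hn⟩
      refine ⟨n + 1, ?_⟩
      rw [hM]
      refine Or.inr (Set.mem_iUnion.2 ⟨i, Or.inr ?_⟩)
      rwa [Set.mem_preimage, Bij.inv_apply_self]

/-- Cutting and pasting modulo null sets. -/
theorem exists_glue_ae {G : Subgroup (Aut μ)} (hfull : IsFull G) {ι : Type*} [Countable ι]
    (A : ι → Set X) (T : ι → Bij μ) (hA : ∀ i, MeasurableSet (A i)) (hT : ∀ i, T i ∈ lift G)
    (h1 : ∀ᵐ x ∂μ, ∃! i, x ∈ A i) (h2 : ∀ᵐ y ∂μ, ∃! i, ((T i)⁻¹) y ∈ A i) :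
    ∃ S ∈ lift G, (∀ i, ∀ᵐ x ∂μ, x ∈ A i → S x = T i x) ∧
      ∀ x, S x = x ∨ ∃ i, x ∈ A i ∧ S x = T i x := by
  -- The bad points lie in a null set `M` preserved by every `T i`; adding `M` as a piece with the
  -- identity on it gives an exact partition.
  obtain ⟨M, hNM, hM, hM0, hinv⟩ := exists_null_invariant T (ae_iff.1 (h1.and h2))
  have hout : ∀ x ∉ M, (∃! i, x ∈ A i) ∧ ∃! i, ((T i)⁻¹) x ∈ A i := fun x hx => by
    by_contra hc
    exact hx (hNM hc)
  have hinv' : ∀ i x, ((T i)⁻¹) x ∈ M ↔ x ∈ M := fun i x => by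
    rw [← hinv i, Bij.apply_inv_self]
  let A' : Option ι → Set X := fun o => o.elim M (fun i => A i \ M)
  let T' : Option ι → Bij μ := fun o => o.elim 1 T
  obtain ⟨S, hSG, hS⟩ := exists_glue hfull A' T' (by
      rintro (_ | i)
      · exact hM
      · exact (hA i).diff hM) (by
      rintro (_ | i)
      · exact one_mem _
      · exact hT i) (by
      intro x
      by_cases hx : x ∈ M
      · refine ⟨none, hx, ?_⟩
        rintro (_ | i) hi
        · rfl
        · exact absurd hx hi.2
      · obtain ⟨i, hi, hu⟩ := (hout x hx).1
        refine ⟨some i, ⟨hi, hx⟩, ?_⟩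
        rintro (_ | j) hj
        · exact absurd hj hx
        · rw [hu j hj.1]) (by
      intro x
      by_cases hx : x ∈ M
      · refine ⟨none, hx, ?_⟩
        rintro (_ | i) hi
        · rfl
        · exact absurd ((hinv' i x).2 hx) hi.2
      · obtain ⟨i, hi, hu⟩ := (hout x hx).2
        refine ⟨some i, ⟨hi, fun h => hx ((hinv' i x).1 h)⟩, ?_⟩
        rintro (_ | j) hj
        · exact absurd hj hx
        · rw [hu j hj.1])
  have hM' : ∀ᵐ x ∂μ, x ∉ M := measure_eq_zero_iff_ae_notMem.1 hM0
  refine ⟨S, hSG, fun i => ?_, fun x => ?_⟩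
  · filter_upwards [hM'] with x hx hi
    exact hS (some i) x ⟨hi, hx⟩
  · by_cases hx : x ∈ M
    · exact Or.inl (hS none x hx)
    · obtain ⟨i, hi, -⟩ := (hout x hx).1
      exact Or.inr ⟨i, hi, hS (some i) x ⟨hi, hx⟩⟩

end Glue

/-! ### Subsets of prescribed measure -/

section Atomless

variable {X : Type*} [MeasurableSpace X] [StandardBorelSpace X] (μ : Measure X)
  [IsProbabilityMeasure μ] [NullSingletonClass μ]

/-- A Borel embedding into (0, 1] pushes the restriction of `μ` to `A` to an atomless measure on the
line. Its distribution function is continuous, so the intermediate value theorem applies. -/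
theorem exists_subset_measureReal_eq {A : Set X} (hA : MeasurableSet A) {r : ℝ} (h0 : 0 ≤ r)
    (hr : r ≤ μ.real A) : ∃ B ⊆ A, MeasurableSet B ∧ μ.real B = r := by
  let e : X → ℝ := fun x => (unitInterval.sigmoid (embeddingReal X x) : ℝ)
  have he : MeasurableEmbedding e := (MeasurableEmbedding.subtype_coe measurableSet_Icc).comp
    (measurableEmbedding_sigmoid_comp_embeddingReal X)
  have he0 : ∀ x, 0 < e x := fun x => Real.sigmoid_pos _
  have he1 : ∀ x, e x ≤ 1 := fun x => (unitInterval.sigmoid (embeddingReal X x)).2.2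
  let ν : Measure ℝ := (μ.restrict A).map e
  have hν : ∀ s, MeasurableSet s → ν.real s = μ.real (e ⁻¹' s ∩ A) := fun s hs => by
    simp only [ν, Measure.real, he.map_apply, Measure.restrict_apply (he.measurable hs)]
  have : IsFiniteMeasure ν := by infer_instance
  have : NullSingletonClass ν := ⟨fun t => by
    rw [he.map_apply]
    exact (Set.subsingleton_singleton.preimage he.injective).measure_zero _⟩
  let F : ℝ → ℝ := fun b => ∫ _ in (0 : ℝ)..b, (1 : ℝ) ∂ν
  have hF : Continuous F := intervalIntegral.continuous_primitive
    (fun a b => intervalIntegrable_const) 0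
  have hF' : ∀ b, 0 ≤ b → F b = μ.real (e ⁻¹' (Set.Ioc 0 b) ∩ A) := fun b hb => by
    simp only [F]
    rw [intervalIntegral.integral_const', Set.Ioc_eq_empty (not_lt.2 hb), hν _ measurableSet_Ioc]
    simp
  have h1 : F 1 = μ.real A := by
    rw [hF' 1 zero_le_one]
    congr 1
    exact Set.inter_eq_right.2 fun x _ => ⟨he0 x, he1 x⟩
  have h0' : F 0 = 0 := intervalIntegral.integral_same
  obtain ⟨b, hb, hFb⟩ := intermediate_value_Icc zero_le_one hF.continuousOn
    (show r ∈ Set.Icc (F 0) (F 1) by rw [h0', h1]; exact ⟨h0, hr⟩)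
  refine ⟨e ⁻¹' Set.Ioc 0 b ∩ A, Set.inter_subset_right,
    (he.measurable measurableSet_Ioc).inter hA, ?_⟩
  rw [← hF' b hb.1, hFb]

theorem exists_between_measureReal_eq {A C : Set X} (hA : MeasurableSet A) (hC : MeasurableSet C)
    (hAC : A ⊆ C) {r : ℝ} (h0 : μ.real A ≤ r) (hr : r ≤ μ.real C) :
    ∃ B, A ⊆ B ∧ B ⊆ C ∧ MeasurableSet B ∧ μ.real B = r := by
  have h := measureReal_sdiff_add_inter (μ := μ) (s := C) hA
  rw [Set.inter_eq_right.2 hAC] at h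
  obtain ⟨B, hB, hBm, hBr⟩ := exists_subset_measureReal_eq μ (hC.diff hA) (r := r - μ.real A)
    (by linarith) (by linarith)
  refine ⟨A ∪ B, Set.subset_union_left, Set.union_subset hAC (hB.trans Set.sdiff_subset),
    hA.union hBm, ?_⟩
  rw [measureReal_union (Set.disjoint_left.2 fun x hx hx' => (hB hx').2 hx) hBm, hBr]
  ring

end Atomless

/-- The index `none` stands for the leftover set, on which the gluings below use the identity. -/
theorem existsUnique_option_elim_compl {X ι : Type*} {D : ι → Set X}
    (hD : Pairwise (Function.onFun Disjoint D)) (x : X) :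
    ∃! o : Option ι, x ∈ o.elim (⋃ i, D i)ᶜ D := by
  by_cases h : x ∈ ⋃ i, D i
  · obtain ⟨i, hi⟩ := Set.mem_iUnion.1 h
    refine ⟨some i, hi, ?_⟩
    rintro (_ | j) hj
    · exact absurd h hj
    · by_contra hij
      exact Set.disjoint_left.1 (hD (fun h => hij (congrArg some h))) hj hi
  · refine ⟨none, h, ?_⟩
    rintro (_ | j) hj
    · rfl
    · exact absurd (Set.mem_iUnion.2 ⟨j, hj⟩) h

/-! ### Carrying sets onto sets of equal measure -/

section Transport

variable {X : Type*} [MeasurableSpace X] {μ : Measure X}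

/-- The sets `A i` and `T i '' A i`. -/
def swapPieces {ι : Type*} (A : ι → Set X) (T : ι → Bij μ) (p : ι × Bool) : Set X :=
  if p.2 then A p.1 else ((T p.1)⁻¹ : Bij μ) ⁻¹' A p.1

/-- The involution exchanging `A i` and `T i '' A i` through `T i`, when all these sets are
disjoint. -/
theorem exists_swap_family {G : Subgroup (Aut μ)} (hfull : IsFull G) {ι : Type*} [Countable ι]
    (A : ι → Set X) (T : ι → Bij μ) (hA : ∀ i, MeasurableSet (A i)) (hT : ∀ i, T i ∈ lift G)
    (hd : Pairwise (Function.onFun Disjoint (swapPieces A T))) :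
    ∃ U ∈ lift G, (∀ x, U (U x) = x) ∧ (∀ i, ∀ x ∈ A i, U x = T i x) ∧
      ∀ x, (∀ i, x ∉ A i ∧ ((T i)⁻¹) x ∉ A i) → U x = x := by
  let R : Option (ι × Bool) → Bij μ :=
    fun o => o.elim 1 fun p => if p.2 then T p.1 else (T p.1)⁻¹
  -- `R o` sends its piece onto the piece with the Boolean flipped, so the images form the same
  -- partition, permuted.
  have hR : ∀ (o : Option (ι × Bool)) y,
      ((R o)⁻¹) y ∈ o.elim (⋃ i, swapPieces A T i)ᶜ (swapPieces A T) ↔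
      y ∈ (o.map fun p => (p.1, !p.2)).elim (⋃ i, swapPieces A T i)ᶜ (swapPieces A T) := by
    rintro (_ | ⟨i, _ | _⟩) y
    · exact Iff.rfl
    · simp [R, swapPieces, Bij.inv_apply_self]
    · simp [R, swapPieces]
  have hmeas : ∀ p, MeasurableSet (swapPieces A T p) := by
    rintro ⟨i, _ | _⟩
    · exact (T i)⁻¹.measurable (hA i)
    · exact hA i
  obtain ⟨U, hU, hUR⟩ := exists_glue hfull
    (fun o : Option (ι × Bool) => o.elim (⋃ i, swapPieces A T i)ᶜ (swapPieces A T)) R (by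
      rintro (_ | p)
      · exact (MeasurableSet.iUnion hmeas).compl
      · exact hmeas p) (by
      rintro (_ | ⟨i, _ | _⟩)
      · exact one_mem _
      · exact inv_mem (hT i)
      · exact hT i) (existsUnique_option_elim_compl hd) (by
      intro y
      obtain ⟨o, ho, hu⟩ := existsUnique_option_elim_compl hd y
      refine ⟨o.map fun p => (p.1, !p.2), ?_, fun o' ho' => ?_⟩
      · refine (hR _ _).2 ?_
        rcases o with _ | ⟨i, _ | _⟩ <;> exact ho
      · have := hu _ ((hR _ _).1 ho')
        rw [← this]
        rcases o' with _ | ⟨i, _ | _⟩ <;> rfl)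
  have h1 : ∀ i, ∀ x ∈ A i, U x = T i x := fun i x hx => hUR (some (i, true)) x hx
  have h2 : ∀ i x, ((T i)⁻¹) x ∈ A i → U x = ((T i)⁻¹) x :=
    fun i x hx => hUR (some (i, false)) x hx
  have h3 : ∀ x, (∀ i, x ∉ A i ∧ ((T i)⁻¹) x ∉ A i) → U x = x := by
    intro x hx
    refine hUR none x fun h => ?_
    obtain ⟨⟨i, _ | _⟩, hi⟩ := Set.mem_iUnion.1 h
    · exact (hx i).2 hi
    · exact (hx i).1 hi
  refine ⟨U, hU, fun x => ?_, h1, h3⟩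
  by_cases hx : ∀ i, x ∉ A i ∧ ((T i)⁻¹) x ∉ A i
  · rw [h3 x hx, h3 x hx]
  · simp only [not_forall, not_and_or, not_not] at hx
    obtain ⟨i, hi | hi⟩ := hx
    · rw [h1 i x hi, h2 i _ (by rwa [Bij.inv_apply_self]), Bij.inv_apply_self]
    · rw [h2 i x hi, h1 i _ hi, Bij.apply_inv_self]

/-- The involution exchanging `A` and `T '' A` through `T`, when these sets are disjoint. -/
theorem exists_swap {G : Subgroup (Aut μ)} (hfull : IsFull G) {A : Set X} {T : Bij μ}
    (hA : MeasurableSet A) (hT : T ∈ lift G) (hd : ∀ x ∈ A, T x ∉ A) :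
    ∃ U ∈ lift G, (∀ x, U (U x) = x) ∧ (∀ x ∈ A, U x = T x) ∧
      ∀ x, x ∉ A → ((T)⁻¹) x ∉ A → U x = x := by
  obtain ⟨U, hU, h1, h2, h3⟩ := exists_swap_family hfull (fun _ : Unit => A) (fun _ => T)
    (fun _ => hA) (fun _ => hT) (by
      have key : Disjoint A (((T)⁻¹ : Bij μ) ⁻¹' A) :=
        Set.disjoint_left.2 fun x hx hx' => hd _ hx' (by rwa [Bij.apply_inv_self])
      rintro ⟨_, _ | _⟩ ⟨_, _ | _⟩ h
      · exact absurd rfl h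
      · exact key.symm
      · exact key
      · exact absurd rfl h)
  exact ⟨U, hU, h1, h2 (), fun x hx hx' => h3 x fun _ => ⟨hx, hx'⟩⟩

/-- An ergodic group carries a nonnull part of any nonnull set into any other. -/
theorem exists_mem_lift_inter_preimage_pos [IsProbabilityMeasure μ] {G : Subgroup (Aut μ)}
    (herg : IsErgodic G) {A B : Set X} (hB : MeasurableSet B)
    (hA0 : μ A ≠ 0) (hB0 : μ B ≠ 0) : ∃ T ∈ lift G, μ (A ∩ T ⁻¹' B) ≠ 0 := by
  by_contra! hc
  -- `C` is stable under countable unions and under the group, so a member `E` of maximal measure is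
  -- invariant. By ergodicity `E` is null, contradicting `B ∈ C`, or conull, making `A` null.
  let C : Set (Set X) := {D | MeasurableSet D ∧ ∀ T ∈ lift G, μ (A ∩ T ⁻¹' D) = 0}
  have hBC : B ∈ C := ⟨hB, hc⟩
  have hCU : ∀ D : ℕ → Set X, (∀ n, D n ∈ C) → (⋃ n, D n) ∈ C := fun D hD =>
    ⟨.iUnion fun n => (hD n).1, fun T hT => by
      rw [Set.preimage_iUnion, Set.inter_iUnion]
      exact measure_iUnion_null fun n => (hD n).2 T hT⟩
  obtain ⟨u, -, hu, huC⟩ := exists_seq_tendsto_sSup (S := μ '' C) ⟨_, _, hBC, rfl⟩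
    (OrderTop.bddAbove _)
  choose D hD hDu using huC
  obtain rfl : (fun n => μ (D n)) = u := funext hDu
  set E := ⋃ n, D n
  have hE : E ∈ C := hCU D hD
  have hmax : ∀ F ∈ C, μ F ≤ μ E := fun F hF => by
    refine (le_sSup (Set.mem_image_of_mem μ hF)).trans
      (le_of_tendsto hu (Eventually.of_forall fun n => measure_mono (Set.subset_iUnion D n)))
  have hinv : ∀ T : Bij μ, Aut.mk T ∈ G → T '' E =ᵐ[μ] E := by
    intro T hT
    have hTE : T '' E ∈ C := ⟨T.measurableSet_image hE.1, fun S hS => by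
      have := hE.2 (T⁻¹ * S) (mul_mem (inv_mem hT) hS)
      rwa [Bij.image_eq]⟩
    have hU : E ∪ T '' E ∈ C := by
      refine ⟨hE.1.union hTE.1, fun S hS => ?_⟩
      rw [Set.preimage_union, Set.inter_union_distrib_left]
      exact measure_union_null (hE.2 S hS) (hTE.2 S hS)
    have h1 : E =ᵐ[μ] (E ∪ T '' E : Set X) :=
      ae_eq_of_subset_of_measure_ge Set.subset_union_left (hmax _ hU) hE.1.nullMeasurableSet
        (measure_ne_top _ _)
    have h2 : T '' E =ᵐ[μ] (E ∪ T '' E : Set X) := by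
      refine ae_eq_of_subset_of_measure_ge Set.subset_union_right ?_ hTE.1.nullMeasurableSet
        (measure_ne_top _ _)
      rw [Bij.image_eq T E, Bij.measure_preimage, ← Bij.image_eq]
      exact hmax _ hU
    exact h2.trans h1.symm
  rcases herg E hE.1 hinv with h | h
  · have : μ E = 0 := by rw [measure_congr h, measure_empty]
    exact hB0 (le_antisymm (this ▸ hmax B hBC) (zero_le))
  · refine hA0 ?_
    have := hE.2 1 (one_mem _)
    rw [← this]
    refine measure_congr ?_
    filter_upwards [h] with x hx
    have hxE : x ∈ E := by
      have : E x = True := hx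
      exact this.mpr trivial
    exact propext ⟨fun h => ⟨h, hxE⟩, fun h => h.1⟩

/-- Two disjoint sets of equal measure are exchanged by an involution supported on their union. -/
theorem exists_involution_exchange [IsProbabilityMeasure μ] {G : Subgroup (Aut μ)}
    (hfull : IsFull G) (herg : IsErgodic G) {A B : Set X} (hA : MeasurableSet A)
    (hB : MeasurableSet B) (hAB : Disjoint A B) (hμ : μ A = μ B) :
    ∃ U ∈ lift G, (∀ x, U (U x) = x) ∧ (∀ x, x ∉ A → x ∉ B → U x = x) ∧
      ∀ᵐ x ∂μ, x ∈ A ↔ U x ∈ B := by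
  -- Exhaustion: take a maximal family of nonnull pieces of `A` carried into `B`, with disjoint
  -- pieces and disjoint images. The leftovers in `A` and `B` have equal measure; were they nonnull,
  -- ergodicity would supply a further piece.
  let M := {m : Bij μ × Set X // m.1 ∈ lift G ∧ MeasurableSet m.2 ∧ m.2 ⊆ A ∧
    (∀ x ∈ m.2, m.1 x ∈ B) ∧ μ m.2 ≠ 0}
  obtain ⟨S, hS⟩ := zorn_subset
    {S : Set M | S.Pairwise fun m n => Disjoint m.1.2 n.1.2 ∧
      Disjoint (m.1.1 '' m.1.2) (n.1.1 '' n.1.2)} (by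
    intro c hc hchain
    refine ⟨⋃₀ c, ?_, fun s hs => Set.subset_sUnion_of_mem hs⟩
    exact (Set.pairwise_sUnion hchain.directedOn).2 fun s hs => hc hs)
  have hScount : S.Countable := by
    have h := Measure.countable_meas_pos_of_disjoint_iUnion (μ := μ) (As := fun m : S => m.1.1.2)
      (fun m => m.1.2.2.1) (fun m n hmn => (hS.prop m.2 n.2 (fun h => hmn (Subtype.ext h))).1)
    have : {i : S | 0 < μ i.1.1.2} = Set.univ :=
      Set.eq_univ_of_forall fun m => pos_iff_ne_zero.2 m.1.2.2.2.2.2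
    rw [this] at h
    exact Set.countable_coe_iff.1 (Set.countable_univ_iff.1 h)
  have := hScount.to_subtype
  let P : S → Set X := fun m => m.1.1.2
  let T : S → Bij μ := fun m => m.1.1.1
  have hPm : ∀ m, MeasurableSet (P m) := fun m => m.1.2.2.1
  have hPA : ∀ m, P m ⊆ A := fun m => m.1.2.2.2.1
  have hPB : ∀ m, ∀ x ∈ P m, T m x ∈ B := fun m => m.1.2.2.2.2.1
  have hPB' : ∀ m x, ((T m)⁻¹) x ∈ P m → x ∈ B := fun m x hx => by
    have := hPB m _ hx
    rwa [Bij.apply_inv_self] at this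
  have hT : ∀ m, T m ∈ lift G := fun m => m.1.2.1
  have hd1 : Pairwise (Function.onFun Disjoint P) := fun m n hmn =>
    (hS.prop m.2 n.2 (fun h => hmn (Subtype.ext h))).1
  have hd2 : Pairwise (Function.onFun Disjoint fun m => T m '' P m) := fun m n hmn =>
    (hS.prop m.2 n.2 (fun h => hmn (Subtype.ext h))).2
  have hsum : μ (⋃ m, P m) = μ (⋃ m, T m '' P m) := by
    rw [measure_iUnion hd1 hPm, measure_iUnion hd2 fun m => (T m).measurableSet_image (hPm m)]
    exact tsum_congr fun m => by rw [Bij.image_eq, Bij.measure_preimage]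
  have hA' : MeasurableSet (⋃ m, P m) := .iUnion hPm
  have hB' : MeasurableSet (⋃ m, T m '' P m) :=
    .iUnion fun m => (T m).measurableSet_image (hPm m)
  have hsA : (⋃ m, P m) ⊆ A := Set.iUnion_subset hPA
  have hsB : (⋃ m, T m '' P m) ⊆ B := by
    refine Set.iUnion_subset fun m => ?_
    rintro _ ⟨x, hx, rfl⟩
    exact hPB m x hx
  have hrem : μ (A \ ⋃ m, P m) = μ (B \ ⋃ m, T m '' P m) := by
    rw [measure_sdiff hsA hA'.nullMeasurableSet (measure_ne_top _ _),
      measure_sdiff hsB hB'.nullMeasurableSet (measure_ne_top _ _), hμ, hsum]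
  have hzero : μ (A \ ⋃ m, P m) = 0 := by
    by_contra h0
    obtain ⟨R, hR, hR0⟩ := exists_mem_lift_inter_preimage_pos herg (hB.diff hB') h0
      (hrem ▸ h0)
    let m₀ : M := ⟨(R, (A \ ⋃ m, P m) ∩ R ⁻¹' (B \ ⋃ m, T m '' P m)), hR,
      (hA.diff hA').inter (R.measurable (hB.diff hB')), fun x hx => hx.1.1,
      fun x hx => hx.2.1, hR0⟩
    have hdis : ∀ m ∈ S, Disjoint m₀.1.2 m.1.2 ∧
        Disjoint (m₀.1.1 '' m₀.1.2) (m.1.1 '' m.1.2) := by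
      intro m hm
      constructor
      · exact Set.disjoint_left.2 fun x hx hx' => hx.1.2 (Set.mem_iUnion.2 ⟨⟨m, hm⟩, hx'⟩)
      · refine Set.disjoint_left.2 ?_
        rintro _ ⟨x, hx, rfl⟩ hx'
        exact hx.2.2 (Set.mem_iUnion.2 ⟨⟨m, hm⟩, hx'⟩)
    have hins : insert m₀ S ∈ {S : Set M | S.Pairwise fun m n => Disjoint m.1.2 n.1.2 ∧
        Disjoint (m.1.1 '' m.1.2) (n.1.1 '' n.1.2)} :=
      hS.prop.insert fun m hm _ => ⟨hdis m hm, (hdis m hm).1.symm, (hdis m hm).2.symm⟩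
    have hmem : m₀ ∈ S := hS.le_of_ge hins (Set.subset_insert _ _) (Set.mem_insert _ _)
    have := (hdis m₀ hmem).1
    rw [disjoint_self] at this
    exact hR0 (by
      have h : (A \ ⋃ m, P m) ∩ R ⁻¹' (B \ ⋃ m, T m '' P m) = ∅ := this
      rw [h, measure_empty])
  obtain ⟨U, hU, hUU, hUT, hU1⟩ := exists_swap_family hfull P T hPm hT (by
    rintro ⟨m, _ | _⟩ ⟨n, _ | _⟩ h
    · have hmn : m ≠ n := fun h' => h (by rw [h'])
      have := hd2 hmn
      simpa [Function.onFun, Bij.image_eq, swapPieces] using this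
    · exact Set.disjoint_left.2 fun x hx hx' =>
        Set.disjoint_left.1 hAB (hPA n hx') (hPB' m x hx)
    · exact Set.disjoint_left.2 fun x hx hx' =>
        Set.disjoint_left.1 hAB (hPA m hx) (hPB' n x hx')
    · have hmn : m ≠ n := fun h' => h (by rw [h'])
      exact hd1 hmn)
  refine ⟨U, hU, hUU, fun x hxA hxB => hU1 x fun m =>
    ⟨fun h => hxA (hPA m h), fun h => hxB (hPB' m x h)⟩, ?_⟩
  have key1 : ∀ᵐ x ∂μ, x ∈ A → U x ∈ B := by
    filter_upwards [measure_eq_zero_iff_ae_notMem.1 hzero] with x hx hxA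
    have : x ∈ ⋃ m, P m := by
      by_contra h
      exact hx ⟨hxA, h⟩
    obtain ⟨m, hm⟩ := Set.mem_iUnion.1 this
    rw [hUT m x hm]
    exact hPB m x hm
  have key2 : ∀ᵐ x ∂μ, x ∈ B → U x ∈ A := by
    filter_upwards [measure_eq_zero_iff_ae_notMem.1 (hrem ▸ hzero)] with x hx hxB
    have : x ∈ ⋃ m, T m '' P m := by
      by_contra h
      exact hx ⟨hxB, h⟩
    obtain ⟨m, y, hy, rfl⟩ := Set.mem_iUnion.1 this
    rw [← hUT m y hy, hUU]
    exact hPA m hy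
  filter_upwards [key1, U.ae key2] with x h1 h2
  exact ⟨h1, fun h => by simpa [hUU] using h2 h⟩

/-- Sets of equal measure are equivalent under an ergodic full group. -/
theorem exists_mem_lift_carry [IsProbabilityMeasure μ] {G : Subgroup (Aut μ)}
    (hfull : IsFull G) (herg : IsErgodic G) {A B : Set X} (hA : MeasurableSet A)
    (hB : MeasurableSet B) (hμ : μ A = μ B) :
    ∃ T ∈ lift G, ∀ᵐ x ∂μ, x ∈ A ↔ T x ∈ B := by
  -- It suffices to exchange `A \ B` with `B \ A`, since the involution fixes `A ∩ B`.
  obtain ⟨U, hU, hUU, hU1, hUAB⟩ := exists_involution_exchange hfull herg (hA.diff hB)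
    (hB.diff hA) (Set.disjoint_left.2 fun x hx hx' => hx'.2 hx.1) (by
      have h1 := measure_inter_add_sdiff (μ := μ) A hB
      have h2 := measure_inter_add_sdiff (μ := μ) B hA
      rw [Set.inter_comm, ← hμ, ← h1, Set.inter_comm] at h2
      exact ((ENNReal.add_right_inj (measure_ne_top _ _)).1 h2).symm)
  refine ⟨U, hU, ?_⟩
  filter_upwards [hUAB, U.ae hUAB] with x h1 h2
  rw [hUU] at h2
  simp only [Set.mem_sdiff] at h1 h2
  by_cases hxA : x ∈ A <;> by_cases hxB : x ∈ B
  · have : U x = x := hU1 x (fun h => h.2 hxB) (fun h => h.2 hxA)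
    rw [this]; tauto
  · tauto
  · have := h2.2 ⟨hxB, hxA⟩
    tauto
  · have : U x = x := hU1 x (fun h => hxA h.1) (fun h => hxB h.1)
    rw [this]; tauto

end Transport

/-! ### Involutions: conjugacy, existence and commutators -/

section Involutions

variable {X : Type*} [MeasurableSpace X] {μ : Measure X}

/-- The set of points moved by `T`. -/
def Bij.supp (T : Bij μ) : Set X := {x | T x ≠ x}

theorem Bij.notMem_supp {T : Bij μ} {x : X} : x ∉ T.supp ↔ T x = x := not_not

theorem Bij.measurableSet_supp [StandardBorelSpace X] (T : Bij μ) : MeasurableSet T.supp :=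
  (measurableSet_eq_fun T.measurable measurable_id).compl

theorem Bij.apply_mem_iff {T : Bij μ} {B : Set X} (h : ∀ x ∉ B, T x = x) (x : X) :
    T x ∈ B ↔ x ∈ B := by
  constructor
  · intro hx
    by_contra hc
    exact hc (h x hc ▸ hx)
  · intro hx
    by_contra hc
    exact hc (by rwa [T.injective (h _ hc)])

/-- An element that is trivial almost everywhere off `B` can be modified on a null set so as to be
trivial off `B`. -/
theorem exists_supported {G : Subgroup (Aut μ)} (hfull : IsFull G) {T : Bij μ} {B : Set X}
    (hT : T ∈ lift G) (hB : MeasurableSet B) (h : ∀ᵐ x ∂μ, x ∉ B → T x = x) :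
    ∃ S ∈ lift G, (∀ᵐ x ∂μ, S x = T x) ∧ ∀ x ∉ B, S x = x := by
  have hinv : ∀ᵐ x ∂μ, T x ∈ B ↔ x ∈ B := by
    filter_upwards [h, T.ae h] with x h1 h2
    constructor
    · intro hx
      by_contra hc
      exact hc (h1 hc ▸ hx)
    · intro hx
      by_contra hc
      exact hc (by rwa [T.injective (h2 hc)])
  obtain ⟨S, hS, hST, hS'⟩ := exists_glue_ae hfull (fun b : Bool => if b then B else Bᶜ)
    (fun b => if b then T else 1) (by rintro (_ | _) <;> simp [hB])
    (by rintro (_ | _) <;> simp [hT, one_mem])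
    (Eventually.of_forall fun x => by
      by_cases hx : x ∈ B
      · exact ⟨true, hx, by rintro (_ | _) h <;> simp_all⟩
      · exact ⟨false, hx, by rintro (_ | _) h <;> simp_all⟩) (by
      filter_upwards [(T⁻¹ : Bij μ).ae hinv] with y hy
      rw [Bij.apply_inv_self] at hy
      by_cases hx : y ∈ B
      · refine ⟨true, hy.1 hx, ?_⟩
        rintro (_ | _) h
        · exact absurd hx h
        · rfl
      · refine ⟨false, hx, ?_⟩
        rintro (_ | _) h
        · rfl
        · exact absurd (hy.2 h) hx)
  refine ⟨S, hS, ?_, fun x hx => ?_⟩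
  · filter_upwards [hST true, hST false, h] with x h1 h2 h3
    by_cases hx : x ∈ B
    · exact h1 hx
    · rw [h3 hx]; exact h2 hx
  · rcases hS' x with h | ⟨_ | _, hi, h⟩
    · exact h
    · exact h
    · exact absurd hi hx

/-- Greedy construction: at stage `n`, add the points of `C n` whose image and preimage both avoid
the set built so far. A rejected point has its image or preimage in that set. -/
theorem exists_separated_of_iUnion_cover {T : Bij μ} {C : ℕ → Set X}
    (hC : ∀ n, MeasurableSet (C n)) (hCT : ∀ n, ∀ x ∈ C n, T x ∉ C n) :
    ∃ A, MeasurableSet A ∧ (∀ x ∈ A, T x ∉ A) ∧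
      (∀ x ∈ ⋃ n, C n, x ∈ A ∨ T x ∈ A ∨ ((T)⁻¹) x ∈ A) := by
  let F : ℕ → Set X := fun n => Nat.rec ∅
    (fun n F => F ∪ (C n \ (T ⁻¹' F ∪ ((T)⁻¹ : Bij μ) ⁻¹' F))) n
  have hF : ∀ n, F (n + 1) = F n ∪ (C n \ (T ⁻¹' F n ∪ ((T)⁻¹ : Bij μ) ⁻¹' F n)) := fun _ => rfl
  have hmono : Monotone F := monotone_nat_of_le_succ fun n => by
    rw [hF]; exact Set.subset_union_left
  have hsep : ∀ n, ∀ x ∈ F n, T x ∉ F n := by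
    intro n
    induction n with
    | zero => intro x hx; exact absurd hx (Set.notMem_empty _)
    | succ n ih =>
      intro x hx hx'
      rw [hF] at hx hx'
      rcases hx with hx | ⟨hx, hx1⟩
      · rcases hx' with hx' | ⟨hx', hx2⟩
        · exact ih x hx hx'
        · refine hx2 (Or.inr ?_)
          rwa [Set.mem_preimage, Bij.inv_apply_self]
      · rcases hx' with hx' | ⟨hx', hx2⟩
        · exact hx1 (Or.inl hx')
        · exact hCT n x hx hx'
  refine ⟨⋃ n, F n, .iUnion fun n => ?_, ?_, ?_⟩
  · induction n with
    | zero => exact .empty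
    | succ n ih =>
      rw [hF]
      exact ih.union ((hC n).diff ((T.measurable ih).union ((T)⁻¹.measurable ih)))
  · intro x hx hx'
    obtain ⟨m, hm⟩ := Set.mem_iUnion.1 hx
    obtain ⟨n, hn⟩ := Set.mem_iUnion.1 hx'
    exact hsep (max m n) x (hmono (le_max_left _ _) hm) (hmono (le_max_right _ _) hn)
  · intro x hx
    obtain ⟨n, hn⟩ := Set.mem_iUnion.1 hx
    by_contra! hc
    simp only [Set.mem_iUnion, not_exists] at hc
    refine hc.1 (n + 1) ?_
    rw [hF]
    refine Or.inr ⟨hn, ?_⟩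
    rintro (h | h)
    · exact hc.2.1 n h
    · exact hc.2.2 n h

/-- The support of `T` is covered by three translates of a set disjoint from its image. -/
theorem exists_separated [StandardBorelSpace X] [IsProbabilityMeasure μ] (T : Bij μ) :
    ∃ A, MeasurableSet A ∧ (∀ x ∈ A, T x ∉ A) ∧ μ.real T.supp ≤ 3 * μ.real A := by
  let e := embeddingReal X
  have he : Measurable e := measurable_embeddingReal X
  -- With `X` embedded in the line, any moved point is separated from its image by a rational; `C q`
  -- fixes the rational and the side.
  let C : ℚ × Bool → Set X := fun q =>
    if q.2 then {x | e x < q.1 ∧ (q.1 : ℝ) < e (T x)} else {x | (q.1 : ℝ) < e x ∧ e (T x) < q.1}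
  have hC : ∀ q, MeasurableSet (C q) := by
    rintro ⟨q, _ | _⟩
    · exact (measurableSet_lt measurable_const he).inter
        (measurableSet_lt (he.comp T.measurable) measurable_const)
    · exact (measurableSet_lt he measurable_const).inter
        (measurableSet_lt measurable_const (he.comp T.measurable))
  have hCT : ∀ q, ∀ x ∈ C q, T x ∉ C q := by
    rintro ⟨q, _ | _⟩ x hx hx'
    · exact lt_asymm hx.2 hx'.1
    · exact lt_asymm hx.2 hx'.1
  obtain ⟨f, hf⟩ := exists_surjective_nat (ℚ × Bool)
  obtain ⟨A, hA, hAT, hcov⟩ := exists_separated_of_iUnion_cover (T := T) (C := fun n => C (f n))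
    (fun n => hC _) (fun n => hCT _)
  refine ⟨A, hA, hAT, ?_⟩
  have hsub : T.supp ⊆ (A ∪ T ⁻¹' A) ∪ ((T)⁻¹ : Bij μ) ⁻¹' A := by
    intro x hx
    have hne : e (T x) ≠ e x := fun h => hx ((measurableEmbedding_embeddingReal X).injective h)
    have : ∃ q, x ∈ C q := by
      rcases lt_or_gt_of_ne hne with h | h
      · obtain ⟨q, hq1, hq2⟩ := exists_rat_btwn h
        exact ⟨(q, false), hq2, hq1⟩
      · obtain ⟨q, hq1, hq2⟩ := exists_rat_btwn h
        exact ⟨(q, true), hq1, hq2⟩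
    obtain ⟨q, hq⟩ := this
    obtain ⟨n, rfl⟩ := hf q
    rcases hcov x (Set.mem_iUnion.2 ⟨n, hq⟩) with h | h | h
    · exact Or.inl (Or.inl h)
    · exact Or.inl (Or.inr h)
    · exact Or.inr h
  calc μ.real T.supp ≤ μ.real ((A ∪ T ⁻¹' A) ∪ ((T)⁻¹ : Bij μ) ⁻¹' A) := measureReal_mono hsub
    _ ≤ μ.real (A ∪ T ⁻¹' A) + μ.real (((T)⁻¹ : Bij μ) ⁻¹' A) := measureReal_union_le _ _
    _ ≤ (μ.real A + μ.real (T ⁻¹' A)) + μ.real (((T)⁻¹ : Bij μ) ⁻¹' A) := by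
      gcongr; exact measureReal_union_le _ _
    _ = 3 * μ.real A := by rw [Bij.measureReal_preimage, Bij.measureReal_preimage]; ring

/-- An involution exchanges a Borel half of its support with the other half. -/
theorem exists_half [StandardBorelSpace X] [IsProbabilityMeasure μ] {U : Bij μ}
    (hU : ∀ x, U (U x) = x) :
    ∃ A, MeasurableSet A ∧ (∀ x, x ∈ U.supp ↔ (x ∈ A ∨ U x ∈ A)) ∧ (∀ x ∈ A, U x ∉ A) ∧
      μ.real U.supp = 2 * μ.real A := by
  let e := embeddingReal X
  have he : Measurable e := measurable_embeddingReal X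
  -- Pick the smaller point of each two-point orbit.
  let A : Set X := {x | e x < e (U x)}
  have hA : MeasurableSet A := measurableSet_lt he (he.comp U.measurable)
  have hd : ∀ x ∈ A, U x ∉ A := fun x hx hx' => by
    have h : e (U x) < e (U (U x)) := hx'
    rw [hU] at h
    exact lt_asymm hx h
  have hs : ∀ x, x ∈ U.supp ↔ (x ∈ A ∨ U x ∈ A) := fun x => by
    constructor
    · intro hx
      have hne : e (U x) ≠ e x := fun h => hx ((measurableEmbedding_embeddingReal X).injective h)
      rcases lt_or_gt_of_ne hne with h | h
      · right
        change e (U x) < e (U (U x))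
        rwa [hU]
      · exact Or.inl h
    · rintro hx h
      have hx' : x ∈ A := by rcases hx with h' | h' <;> simpa [h] using h'
      have : e x < e (U x) := hx'
      rw [h] at this
      exact lt_irrefl _ this
  refine ⟨A, hA, hs, hd, ?_⟩
  have : U.supp = A ∪ U ⁻¹' A := by ext x; exact hs x
  rw [this, measureReal_union (show Disjoint A (U ⁻¹' A) from Set.disjoint_left.2 hd)
    (U.measurable hA),
    Bij.measureReal_preimage]
  ring

/-- Involutions with supports of equal measure are conjugate. -/
theorem exists_conj_involution [StandardBorelSpace X] [IsProbabilityMeasure μ]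
    {G : Subgroup (Aut μ)} (hfull : IsFull G) (herg : IsErgodic G) {U V : Bij μ}
    (hU : U ∈ lift G) (hV : V ∈ lift G) (hUU : ∀ x, U (U x) = x) (hVV : ∀ x, V (V x) = x)
    (hμ : μ.real U.supp = μ.real V.supp) :
    ∃ S ∈ lift G, ∀ᵐ x ∂μ, S (U x) = V (S x) := by
  obtain ⟨A, hA, hAs, hAd, hAμ⟩ := exists_half hUU
  obtain ⟨B, hB, hBs, hBd, hBμ⟩ := exists_half hVV
  have hreal : ∀ s t : Set X, μ.real s = μ.real t → μ s = μ t := fun s t h =>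
    (measureReal_eq_measureReal_iff).1 h
  obtain ⟨R, hR, hRAB⟩ := exists_mem_lift_carry hfull herg hA hB (hreal _ _ (by linarith))
  obtain ⟨Q, hQ, hQc⟩ := exists_mem_lift_carry hfull herg U.measurableSet_supp V.measurableSet_supp
    (hreal _ _ hμ)
  -- Choose `S` as `R` on one half of the support; equivariance then forces `V * R * U` on the other
  -- half. Off the support, `Q` only has to land where `V` is trivial.
  let P : Option Bool → Set X := fun o => o.elim U.suppᶜ fun b => if b then A else U ⁻¹' A
  let T : Option Bool → Bij μ := fun o => o.elim Q fun b => if b then R else V * R * U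
  obtain ⟨S, hS, hST, -⟩ := exists_glue_ae hfull P T (by
      rintro (_ | _ | _)
      · exact U.measurableSet_supp.compl
      · exact U.measurable hA
      · exact hA) (by
      rintro (_ | _ | _)
      · exact hQ
      · exact mul_mem (mul_mem hV hR) hU
      · exact hR) (by
      refine Eventually.of_forall fun x => ?_
      have h1 := hAs x
      have h2 := hAd x
      by_cases hxA : x ∈ A
      · refine ⟨some true, hxA, ?_⟩
        rintro (_ | _ | _) h
        · exact absurd (h1.2 (Or.inl hxA)) h
        · exact absurd h (h2 hxA)
        · rfl
      · by_cases hxU : U x ∈ A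
        · refine ⟨some false, hxU, ?_⟩
          rintro (_ | _ | _) h
          · exact absurd (h1.2 (Or.inr hxU)) h
          · rfl
          · exact absurd h hxA
        · refine ⟨none, fun h => (h1.1 h).elim hxA hxU, ?_⟩
          rintro (_ | _ | _) h
          · rfl
          · exact absurd h hxU
          · exact absurd h hxA) (by
      have hRi := (R⁻¹ : Bij μ).ae hRAB
      have hQi := (Q⁻¹ : Bij μ).ae hQc
      filter_upwards [hRi, hQi, V.ae hRi] with y hr hq hrv
      rw [Bij.apply_inv_self] at hr hq hrv
      have h1 := hBs y
      have h2 := hBd y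
      have t1 : ((T (some true))⁻¹) y ∈ P (some true) ↔ y ∈ B := hr
      have t2 : ((T (some false))⁻¹) y ∈ P (some false) ↔ V y ∈ B := by
        rw [← hrv]
        change U (((V * R * U)⁻¹) y) ∈ A ↔ _
        have : U (((V * R * U)⁻¹) y) = (R⁻¹) (V y) := by
          apply R.injective
          rw [Bij.apply_inv_self, ← hVV (R _)]
          exact congrArg V (Bij.apply_inv_self (V * R * U) y)
        rw [this]
      have t3 : ((T none)⁻¹) y ∈ P none ↔ y ∉ V.supp := not_congr hq
      by_cases hxA : y ∈ B
      · refine ⟨some true, t1.2 hxA, ?_⟩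
        rintro (_ | _ | _) h
        · exact absurd (h1.2 (Or.inl hxA)) (t3.1 h)
        · exact absurd (t2.1 h) (h2 hxA)
        · rfl
      · by_cases hxU : V y ∈ B
        · refine ⟨some false, t2.2 hxU, ?_⟩
          rintro (_ | _ | _) h
          · exact absurd (h1.2 (Or.inr hxU)) (t3.1 h)
          · rfl
          · exact absurd (t1.1 h) hxA
        · refine ⟨none, t3.2 fun h => (h1.1 h).elim hxA hxU, ?_⟩
          rintro (_ | _ | _) h
          · rfl
          · exact absurd (t2.1 h) hxU
          · exact absurd (t1.1 h) hxA)
  refine ⟨S, hS, ?_⟩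
  have hSt : ∀ᵐ x ∂μ, x ∈ A → S x = R x := hST (some true)
  have hSf : ∀ᵐ x ∂μ, U x ∈ A → S x = V (R (U x)) := hST (some false)
  have hSn : ∀ᵐ x ∂μ, x ∉ U.supp → S x = Q x := hST none
  filter_upwards [hSt, hSf, hSn, U.ae hSt, U.ae hSf, hQc] with x h1 h2 h3 h4 h5 h6
  rw [hUU] at h5
  by_cases hx : x ∈ U.supp
  · rcases (hAs x).1 hx with h | h
    · rw [h5 h, h1 h]
    · rw [h4 h, h2 h, hVV]
  · have hQ' : Q x ∉ V.supp := fun h => hx (h6.2 h)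
    rw [Bij.notMem_supp.1 hx, h3 hx, Bij.notMem_supp.1 hQ']

/-- There are involutions with support of any prescribed measure inside a given set. -/
theorem exists_involution_in [StandardBorelSpace X] [IsProbabilityMeasure μ]
    [NullSingletonClass μ] {G : Subgroup (Aut μ)} (hfull : IsFull G) (herg : IsErgodic G)
    {A : Set X} (hA : MeasurableSet A) {r : ℝ} (h0 : 0 ≤ r) (hr : r ≤ μ.real A) :
    ∃ U ∈ lift G, (∀ x, U (U x) = x) ∧ (∀ x ∉ A, U x = x) ∧ μ.real U.supp = r := by
  obtain ⟨B, hBA, hB, hBμ⟩ := exists_subset_measureReal_eq μ hA (r := r / 2) (by linarith)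
    (by linarith)
  have hd : μ.real (A \ B) = μ.real A - r / 2 := by rw [measureReal_sdiff hBA hB, hBμ]
  obtain ⟨C, hCA, hC, hCμ⟩ := exists_subset_measureReal_eq μ (hA.diff hB) (r := r / 2)
    (by linarith) (by linarith)
  have hBC : Disjoint B C := Set.disjoint_left.2 fun x hx hx' => (hCA hx').2 hx
  obtain ⟨U, hU, hUU, hU1, hUB⟩ := exists_involution_exchange hfull herg hB hC hBC
    ((measureReal_eq_measureReal_iff).1 (by rw [hBμ, hCμ]))
  refine ⟨U, hU, hUU, fun x hx => hU1 x (fun h => hx (hBA h)) (fun h => hx (hCA h).1), ?_⟩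
  have : U.supp =ᵐ[μ] (B ∪ C : Set X) := by
    filter_upwards [hUB, U.ae hUB] with x h1 h2
    rw [hUU] at h2
    refine propext ⟨fun h => ?_, ?_⟩
    · by_contra hc
      exact h (hU1 x (fun h => hc (Or.inl h)) (fun h => hc (Or.inr h)))
    · rintro (h | h) heq
      · exact Set.disjoint_left.1 hBC h (heq ▸ h1.1 h)
      · have := h2.2 h
        have heq : U x = x := heq
        rw [heq] at this
        exact Set.disjoint_left.1 hBC this h
  rw [measureReal_congr this, measureReal_union hBC hC, hBμ, hCμ]
  ring

/-- The commutator of `T` with a small involution is an involution with prescribed support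
measure. -/
theorem exists_commutator_involution [StandardBorelSpace X] [IsProbabilityMeasure μ]
    [NullSingletonClass μ] {G : Subgroup (Aut μ)} (hfull : IsFull G) (herg : IsErgodic G)
    (T : Bij μ) {r : ℝ} (h0 : 0 ≤ r) (hr : 3 * r ≤ 2 * μ.real T.supp) :
    ∃ U ∈ lift G, (∀ x, (T * (U * T⁻¹ * U⁻¹)) ((T * (U * T⁻¹ * U⁻¹)) x) = x) ∧
      μ.real (T * (U * T⁻¹ * U⁻¹)).supp = r := by
  obtain ⟨A, hA, hAT, hAμ⟩ := exists_separated T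
  -- The commutator acts as `U` on `A` and as the conjugate of `U` by `T` off `A`, hence the halved
  -- measure.
  obtain ⟨U, hU, hUU, hUA, hUμ⟩ := exists_involution_in hfull herg hA (r := r / 2) (by linarith)
    (by linarith)
  refine ⟨U, hU, ?_⟩
  have hUi : U⁻¹ = U := Bij.ext fun x => U.injective (by rw [Bij.apply_inv_self, hUU])
  have hUm := Bij.apply_mem_iff hUA
  rw [hUi]
  have hc1 : ∀ x ∈ A, (T * (U * T⁻¹ * U)) x = U x := by
    intro x hx
    simp only [Bij.mul_apply]
    rw [hUA ((T⁻¹) (U x)), Bij.apply_inv_self]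
    intro h
    have := hAT _ h
    rw [Bij.apply_inv_self, hUm] at this
    exact this hx
  have hc2 : ∀ x, x ∉ A → (T * (U * T⁻¹ * U)) x = T (U ((T⁻¹) x)) := by
    intro x hx
    simp only [Bij.mul_apply]
    rw [hUA x hx]
  have hTA : ∀ x, (T⁻¹) x ∈ A → x ∉ A := fun x hx => by
    have := hAT _ hx
    rwa [Bij.apply_inv_self] at this
  constructor
  · intro x
    by_cases hx : x ∈ A
    · rw [hc1 x hx, hc1 _ ((hUm x).2 hx), hUU]
    · by_cases hx' : (T⁻¹) x ∈ A
      · rw [hc2 x hx, hc2 _ (hTA _ (by rwa [Bij.inv_apply_self, hUm])), Bij.inv_apply_self, hUU,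
          Bij.apply_inv_self]
      · have : (T * (U * T⁻¹ * U)) x = x := by
          rw [hc2 x hx, hUA _ hx', Bij.apply_inv_self]
        rw [this, this]
  · have hs : (T * (U * T⁻¹ * U)).supp = U.supp ∪ (T⁻¹ : Bij μ) ⁻¹' U.supp := by
      ext x
      have hsA : ∀ y, y ∈ U.supp → y ∈ A := fun y hy => by
        by_contra h; exact hy (hUA y h)
      rw [← not_iff_not, Set.mem_union, not_or, Set.mem_preimage]
      simp only [Bij.notMem_supp]
      by_cases hx : x ∈ A
      · rw [hc1 x hx, hUA ((T⁻¹) x) fun h => hTA x h hx]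
        simp
      · rw [hc2 x hx, hUA x hx]
        constructor
        · intro h
          refine ⟨rfl, T.injective (h.trans (Bij.apply_inv_self T x).symm)⟩
        · rintro ⟨-, h⟩
          rw [h, Bij.apply_inv_self]
    rw [hs, measureReal_union _ ((T⁻¹).measurable U.measurableSet_supp),
      Bij.measureReal_preimage, hUμ]
    · ring
    · refine Set.disjoint_left.2 fun x hx hx' => ?_
      have h1 : x ∈ A := by by_contra h; exact hx (hUA x h)
      have h2 : (T⁻¹) x ∈ A := by by_contra h; exact hx' (hUA _ h)
      exact hTA x h2 h1

end Involutions

/-! ### Small elements as products of six involutions -/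

section Products

variable {X : Type*} [MeasurableSpace X] {μ : Measure X}

/-- `S` is the product of the elements `s i`, supported on the disjoint sets `D i`. -/
structure IsProd {ι : Type*} (D : ι → Set X) (s : ι → Bij μ) (S : Bij μ) : Prop where
  apply_of_mem : ∀ i, ∀ x ∈ D i, S x = s i x
  apply_of_notMem : ∀ x, (∀ i, x ∉ D i) → S x = x

theorem exists_isProd {G : Subgroup (Aut μ)} (hfull : IsFull G) {ι : Type*} [Countable ι]
    {D : ι → Set X} {s : ι → Bij μ} (hD : ∀ i, MeasurableSet (D i)) (hs : ∀ i, s i ∈ lift G)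
    (hd : Pairwise (Function.onFun Disjoint D)) (hsD : ∀ i, ∀ x ∉ D i, s i x = x) :
    ∃ S ∈ lift G, IsProd D s S := by
  obtain ⟨S, hS, h⟩ := exists_glue hfull (fun o : Option ι => o.elim (⋃ i, D i)ᶜ D)
    (fun o => o.elim 1 s) (by
      rintro (_ | i)
      · exact (MeasurableSet.iUnion hD).compl
      · exact hD i) (by
      rintro (_ | i)
      · exact one_mem _
      · exact hs i) (existsUnique_option_elim_compl hd) (by
      intro y
      convert existsUnique_option_elim_compl hd y using 2 with o
      rcases o with _ | i
      · exact Iff.rfl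
      · change (s i)⁻¹ y ∈ D i ↔ y ∈ D i
        rw [← Bij.apply_mem_iff (hsD i), Bij.apply_inv_self])
  refine ⟨S, hS, fun i => h (some i), fun x hx => h none x ?_⟩
  simpa using hx

theorem IsProd.apply_apply {ι : Type*} {D : ι → Set X} {s : ι → Bij μ} {S : Bij μ}
    (h : IsProd D s S) (hsD : ∀ i, ∀ x ∉ D i, s i x = x) (hs : ∀ i x, s i (s i x) = x) (x : X) :
    S (S x) = x := by
  by_cases hx : ∀ i, x ∉ D i
  · rw [h.2 x hx, h.2 x hx]
  · push Not at hx
    obtain ⟨i, hi⟩ := hx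
    rw [h.1 i x hi, h.1 i _ ((Bij.apply_mem_iff (hsD i) x).2 hi), hs]

/-- Conjugation relations between the factors pass to the products. -/
theorem exists_involutions_of_isProd {G : Subgroup (Aut μ)} (hfull : IsFull G)
    {B C : ℕ → Set X} {s t u k : ℕ → Bij μ} {S T : Bij μ}
    (hB : ∀ n, MeasurableSet (B n)) (hC : ∀ n, MeasurableSet (C n))
    (hd : Pairwise (Function.onFun Disjoint fun n => B n ∪ C n))
    (hu : ∀ n, u n ∈ lift G) (hk : ∀ n, k n ∈ lift G)
    (huu : ∀ n x, u n (u n x) = x) (hkk : ∀ n x, k n (k n x) = x)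
    (hsB : ∀ n, ∀ x ∉ B n, s n x = x) (htC : ∀ n, ∀ x ∉ C n, t n x = x)
    (huB : ∀ n, ∀ x ∉ B n, u n x = x) (hkD : ∀ n, ∀ x ∉ B n ∪ C n, k n x = x)
    (hst : ∀ n, ∀ᵐ x ∂μ, s n x = u n (k n (t n (k n x))))
    (hS : IsProd B s S) (hT : IsProd C t T) :
    ∃ U ∈ lift G, ∃ K ∈ lift G, (∀ x, U (U x) = x) ∧ (∀ x, K (K x) = x) ∧
      (∀ x, (∀ n, x ∉ B n ∪ C n) → U x = x) ∧ (∀ x, (∀ n, x ∉ B n ∪ C n) → K x = x) ∧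
      ∀ᵐ x ∂μ, S x = U (K (T (K x))) := by
  have hD : ∀ n, MeasurableSet (B n ∪ C n) := fun n => (hB n).union (hC n)
  have huD : ∀ n, ∀ x ∉ B n ∪ C n, u n x = x := fun n x hx => huB n x fun h => hx (Or.inl h)
  obtain ⟨U, hU, hUp⟩ := exists_isProd hfull hD hu hd huD
  obtain ⟨K, hK, hKp⟩ := exists_isProd hfull hD hk hd hkD
  refine ⟨U, hU, K, hK, hUp.apply_apply huD huu, hKp.apply_apply hkD hkk, hUp.2, hKp.2, ?_⟩
  have huniq : ∀ m n x, x ∈ B m ∪ C m → x ∈ B n ∪ C n → m = n := fun m n x hm hn => by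
    by_contra h
    exact Set.disjoint_left.1 (hd h) hm hn
  have hSD : ∀ n, ∀ x ∈ B n ∪ C n, S x = s n x := by
    intro n x hx
    by_cases hxB : x ∈ B n
    · exact hS.1 n x hxB
    · rw [hsB n x hxB]
      refine hS.2 x fun m hm => hxB ?_
      obtain rfl := huniq m n x (Or.inl hm) hx
      exact hm
  have hTD : ∀ n, ∀ x ∈ B n ∪ C n, T x = t n x := by
    intro n x hx
    by_cases hxC : x ∈ C n
    · exact hT.1 n x hxC
    · rw [htC n x hxC]
      refine hT.2 x fun m hm => hxC ?_
      obtain rfl := huniq m n x (Or.inr hm) hx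
      exact hm
  filter_upwards [ae_all_iff.2 hst] with x hx
  by_cases hxD : ∀ n, x ∉ B n ∪ C n
  · rw [hS.2 x fun n h => hxD n (Or.inl h), hKp.2 x hxD, hT.2 x fun n h => hxD n (Or.inr h),
      hKp.2 x hxD, hUp.2 x hxD]
  · push Not at hxD
    obtain ⟨n, hn⟩ := hxD
    have h1 := (Bij.apply_mem_iff (hkD n) x).2 hn
    have h2 := (Bij.apply_mem_iff (B := B n ∪ C n)
      (fun y hy => htC n y fun h => hy (Or.inr h)) _).2 h1
    have h3 := (Bij.apply_mem_iff (hkD n) _).2 h2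
    rw [hSD n x hn, hKp.1 n x hn, hTD n _ h1, hKp.1 n _ h2, hUp.1 n _ h3, hx n]

/-- Up to an involution and a conjugation by an involution, an element supported on `B` is an
element supported on a set `C` whose measure is two thirds of that of `B`. -/
theorem exists_shrink [StandardBorelSpace X] [IsProbabilityMeasure μ]
    [NullSingletonClass μ] {G : Subgroup (Aut μ)} (hfull : IsFull G) (herg : IsErgodic G)
    {B C : Set X} (hB : MeasurableSet B) (hC : MeasurableSet C) (hBC : Disjoint B C)
    (hμ : 3 * μ.real C = 2 * μ.real B) {T : Bij μ} (hT : T ∈ lift G) (hTB : ∀ x ∉ B, T x = x) :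
    ∃ U K R : Bij μ, U ∈ lift G ∧ K ∈ lift G ∧ R ∈ lift G ∧ (∀ x, U (U x) = x) ∧
      (∀ x, K (K x) = x) ∧ (∀ x ∉ B, U x = x) ∧ (∀ x ∉ B ∪ C, K x = x) ∧ (∀ x ∉ C, R x = x) ∧
      ∀ᵐ x ∂μ, T x = U (K (R (K x))) := by
  obtain ⟨A, hA, hAT, hAμ⟩ := exists_separated T
  have hAs : A ⊆ T.supp := fun x hx h => hAT x hx (by rwa [h])
  have hsB : T.supp ⊆ B := fun x hx => by
    by_contra h
    exact hx (hTB x h)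
  have hTi : ∀ x, T x = x → (T⁻¹) x = x := fun x hx =>
    T.injective (by rw [Bij.apply_inv_self, hx])
  -- As `U` undoes `T` on `A`, the product `U * T` lives on `T.supp \ A`, of measure at most two
  -- thirds of that of `T.supp`. This set is then enlarged to `P`, of the measure of `C`, and moved
  -- onto `C` by `K`.
  obtain ⟨U, hU, hUU, hUA, hU1⟩ := exists_swap hfull hA hT hAT
  have hUs : ∀ x, T x = x → U x = x := fun x hx =>
    hU1 x (fun h => hAs h hx) (fun h => by rw [hTi x hx] at h; exact hAs h hx)
  have hDs : ∀ x, x ∉ T.supp \ A → U (T x) = x := by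
    intro x hx
    by_cases hxA : x ∈ A
    · rw [← hUA x hxA, hUU]
    · have : T x = x := by
        by_contra h
        exact hx ⟨h, hxA⟩
      rw [this, hUs x this]
  have hm1 : μ.real (T.supp \ A) = μ.real T.supp - μ.real A := measureReal_sdiff hAs hA
  have hm2 : μ.real T.supp ≤ μ.real B := measureReal_mono hsB
  obtain ⟨P, hP, hPB, hPm, hPμ⟩ := exists_between_measureReal_eq μ
    (T.measurableSet_supp.diff hA) hB (Set.sdiff_subset.trans hsB) (r := μ.real C)
    (by linarith) (by linarith [measureReal_nonneg (μ := μ) (s := B)])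
  obtain ⟨K, hK, hKK, hK1, hKP⟩ := exists_involution_exchange hfull herg hPm hC
    (hBC.mono_left hPB) ((measureReal_eq_measureReal_iff).1 hPμ)
  obtain ⟨R, hR, hRe, hRC⟩ := exists_supported hfull (T := K * (U * T) * K) (B := C)
    (mul_mem (mul_mem hK (mul_mem hU hT)) hK) hC (by
      filter_upwards [K.ae hKP] with x hx hxC
      rw [hKK] at hx
      change K (U (T (K x))) = x
      rw [hDs _ fun h => hxC (hx.1 (hP h)), hKK])
  refine ⟨U, K, R, hU, hK, hR, hUU, hKK, fun x hx => hUs x (hTB x hx),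
    fun x hx => hK1 x (fun h => hx (Or.inl (hPB h))) (fun h => hx (Or.inr h)), hRC, ?_⟩
  filter_upwards [K.ae hRe] with x hx
  rw [hx]
  change T x = U (K (K (U (T (K (K x))))))
  rw [hKK, hKK, hUU]

theorem exists_geometric_sets [StandardBorelSpace X] [IsProbabilityMeasure μ]
    [NullSingletonClass μ] {B Z : Set X} (hB : MeasurableSet B) (hZ : MeasurableSet Z)
    (hBZ : B ⊆ Z) (hμ : μ.real Z = 3 * μ.real B) :
    ∃ F : ℕ → Set X, F 0 = B ∧ (∀ n, MeasurableSet (F n)) ∧ (∀ n, F n ⊆ Z) ∧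
      Pairwise (Function.onFun Disjoint F) ∧ ∀ n, 3 * μ.real (F (n + 1)) = 2 * μ.real (F n) := by
  set b := μ.real B with hb
  have hb0 : 0 ≤ b := measureReal_nonneg
  -- `d n` is the partial sum of b(2/3)ᵏ for k ≤ n; the full series is 3b, the measure of `Z`. The
  -- sets sought are the successive differences of a chain with measures `d n`.
  let d : ℕ → ℝ := fun n => 3 * b - 3 * b * (2 / 3) ^ (n + 1)
  have hdmono : ∀ n, d n ≤ d (n + 1) := fun n => by
    have : (2 / 3 : ℝ) ^ (n + 1 + 1) ≤ (2 / 3) ^ (n + 1) :=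
      pow_le_pow_of_le_one (by norm_num) (by norm_num) (by lia)
    have := mul_le_mul_of_nonneg_left this (by positivity : 0 ≤ 3 * b)
    simp only [d]
    linarith
  have hdle : ∀ n, d n ≤ 3 * b := fun n => by
    have : 0 ≤ 3 * b * (2 / 3) ^ (n + 1) := by positivity
    simp only [d]
    linarith
  have step : ∀ n (D : {D : Set X // MeasurableSet D ∧ D ⊆ Z ∧ μ.real D = d n}),
      ∃ E : {D : Set X // MeasurableSet D ∧ D ⊆ Z ∧ μ.real D = d (n + 1)}, D.1 ⊆ E.1 := by
    rintro n ⟨D, hD, hDZ, hDμ⟩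
    obtain ⟨E, hDE, hEZ, hE, hEμ⟩ := exists_between_measureReal_eq μ hD hZ hDZ
      (r := d (n + 1)) (hDμ ▸ hdmono n) (hμ ▸ hdle _)
    exact ⟨⟨E, hE, hEZ, hEμ⟩, hDE⟩
  choose N hN using step
  let D : ∀ n, {D : Set X // MeasurableSet D ∧ D ⊆ Z ∧ μ.real D = d n} := fun n =>
    Nat.rec ⟨B, hB, hBZ, by simp only [d, ← hb, Nat.zero_eq, zero_add, pow_one]; ring⟩
      (fun n D => N n D) n
  have hmono : Monotone fun n => (D n).1 := monotone_nat_of_le_succ fun n => hN n (D n)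
  have hsucc : ∀ n, disjointed (fun n => (D n).1) (n + 1) = (D (n + 1)).1 \ (D n).1 := fun n =>
    hmono.disjointed_add_one n
  have hsub := disjointed_subset (fun n => (D n).1)
  have hμs : ∀ n, μ.real (disjointed (fun n => (D n).1) (n + 1)) = b * (2 / 3) ^ (n + 1) := by
    intro n
    have h := measureReal_sdiff (μ := μ) (hN n (D n)) (D n).2.1
    rw [(D n).2.2.2, (N n (D n)).2.2.2] at h
    rw [hsucc]
    refine h.trans ?_
    simp only [d]
    ring
  have h0 : disjointed (fun n => (D n).1) 0 = B := disjointed_zero _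
  refine ⟨disjointed fun n => (D n).1, h0,
    fun n => MeasurableSet.disjointed (fun n => (D n).2.1) n,
    fun n => (hsub n).trans (D n).2.2.1, disjoint_disjointed _, fun n => ?_⟩
  rw [hμs]
  rcases n with _ | n
  · rw [h0]; ring
  · rw [hμs]; ring

/-- An involution in the full group whose support has measure at most `c`. -/
structure IsSmallInvolution (G : Subgroup (Aut μ)) (c : ℝ) (U : Bij μ) : Prop where
  mem : U ∈ lift G
  apply_apply : ∀ x, U (U x) = x
  supp_le : μ.real U.supp ≤ c

theorem IsSmallInvolution.conj {G : Subgroup (Aut μ)} {c : ℝ} {U S : Bij μ}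
    (h : IsSmallInvolution G c U) (hS : S ∈ lift G) :
    IsSmallInvolution G c (S * U * S⁻¹) where
  mem := mul_mem (mul_mem hS h.mem) (inv_mem hS)
  apply_apply x := by
    simp only [Bij.mul_apply]
    rw [Bij.inv_apply_self, h.apply_apply, Bij.apply_inv_self]
  supp_le := by
    refine le_trans (le_of_eq ?_) h.supp_le
    rw [← S.measureReal_preimage]
    congr 1
    ext x
    refine not_congr ?_
    change S (U ((S⁻¹) (S x))) = S x ↔ _
    rw [Bij.inv_apply_self]
    exact S.injective.eq_iff

/-- An element with small support is a product of six small involutions. -/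
theorem exists_eq_prod_involutions [StandardBorelSpace X] [IsProbabilityMeasure μ]
    [NullSingletonClass μ] {G : Subgroup (Aut μ)} (hfull : IsFull G) (herg : IsErgodic G)
    {T : Bij μ} (hT : T ∈ lift G) {c : ℝ} (hTc : 3 * μ.real T.supp ≤ c)
    (hT1 : 3 * μ.real T.supp ≤ 1) :
    ∃ U₁ U₂ U₃ U₄ U₅ U₆ : Bij μ, IsSmallInvolution G c U₁ ∧ IsSmallInvolution G c U₂ ∧
      IsSmallInvolution G c U₃ ∧ IsSmallInvolution G c U₄ ∧ IsSmallInvolution G c U₅ ∧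
      IsSmallInvolution G c U₆ ∧ Aut.mk T = Aut.mk (U₁ * (U₂ * U₃) * U₄ * (U₅ * U₆)) := by
  have hpos : 0 ≤ μ.real T.supp := measureReal_nonneg
  obtain ⟨Z, hTZ, -, hZ, hZμ⟩ := exists_between_measureReal_eq μ T.measurableSet_supp
    MeasurableSet.univ (Set.subset_univ _) (r := 3 * μ.real T.supp) (by linarith)
    (by simpa using hT1)
  obtain ⟨F, hF0, hF, hFZ, hFd, hFμ⟩ := exists_geometric_sets T.measurableSet_supp hZ hTZ hZμ
  have step : ∀ n (T : {T : Bij μ // T ∈ lift G ∧ ∀ x ∉ F n, T x = x}),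
      ∃ (U K : Bij μ) (R : {T : Bij μ // T ∈ lift G ∧ ∀ x ∉ F (n + 1), T x = x}),
        U ∈ lift G ∧ K ∈ lift G ∧ (∀ x, U (U x) = x) ∧ (∀ x, K (K x) = x) ∧
        (∀ x ∉ F n, U x = x) ∧ (∀ x ∉ F n ∪ F (n + 1), K x = x) ∧
        ∀ᵐ x ∂μ, T.1 x = U (K (R.1 (K x))) := by
    rintro n ⟨T, hT, hTF⟩
    obtain ⟨U, K, R, hU, hK, hR, hUU, hKK, hUF, hKF, hRF, h⟩ := exists_shrink hfull herg (hF n)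
      (hF (n + 1)) (hFd (Nat.succ_ne_self n).symm) (hFμ n) hT hTF
    exact ⟨U, K, ⟨R, hR, hRF⟩, hU, hK, hUU, hKK, hUF, hKF, h⟩
  choose u k r hu hk huu hkk huF hkF hr using step
  let t : ∀ n, {T : Bij μ // T ∈ lift G ∧ ∀ x ∉ F n, T x = x} := fun n =>
    Nat.rec ⟨T, hT, fun x hx => by
      rw [hF0] at hx
      exact Bij.notMem_supp.1 hx⟩ (fun n T => r n T) n
  have ht : ∀ n, ∀ᵐ x ∂μ,
      (t n).1 x = u n (t n) (k n (t n) ((t (n + 1)).1 (k n (t n) x))) := fun n => hr n (t n)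
  -- Consecutive relations overlap, so only every second one is used: for fixed `i` these blocks are
  -- disjoint, and the involutions can be multiplied over all `n`.
  have hpair : ∀ i, Pairwise (Function.onFun Disjoint
      fun n => F (2 * n + i) ∪ F (2 * n + i + 1)) := by
    intro i m n hmn
    have : ∀ p q, p ≠ q → Disjoint (F p) (F q) := fun p q h => hFd h
    rw [Function.onFun, Set.disjoint_union_left, Set.disjoint_union_right,
      Set.disjoint_union_right]
    exact ⟨⟨this _ _ (by lia), this _ _ (by lia)⟩, this _ _ (by lia), this _ _ (by lia)⟩
  have hprod : ∀ i, ∃ S ∈ lift G, IsProd (fun n => F (2 * n + i)) (fun n => (t (2 * n + i)).1) S :=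
    fun i => exists_isProd hfull (fun n => hF _) (fun n => (t _).2.1)
      (fun m n hmn => hFd (by lia)) (fun n => (t _).2.2)
  choose S hS hSp using hprod
  have hmain : ∀ i, ∃ U K : Bij μ, IsSmallInvolution G c U ∧ IsSmallInvolution G c K ∧
      Aut.mk (S i) = Aut.mk (U * (K * (S (i + 1) * K))) := by
    intro i
    obtain ⟨U, hU, K, hK, hUU, hKK, hUD, hKD, h⟩ := exists_involutions_of_isProd hfull
      (B := fun n => F (2 * n + i)) (C := fun n => F (2 * n + i + 1))
      (s := fun n => (t (2 * n + i)).1) (t := fun n => (t (2 * n + i + 1)).1)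
      (u := fun n => u _ (t (2 * n + i))) (k := fun n => k _ (t (2 * n + i)))
      (S := S i) (T := S (i + 1))
      (fun n => hF _) (fun n => hF _) (hpair i) (fun n => hu _ _)
      (fun n => hk _ _) (fun n => huu _ _) (fun n => hkk _ _) (fun n => (t _).2.2)
      (fun n => (t _).2.2) (fun n => huF _ _) (fun n => hkF _ _) (fun n => ht _) (hSp i)
      (hSp (i + 1))
    have hsupp : ∀ V : Bij μ, (∀ x, (∀ n, x ∉ F (2 * n + i) ∪ F (2 * n + i + 1)) → V x = x) →
        μ.real V.supp ≤ c := by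
      intro V hV
      refine (measureReal_mono fun x hx => ?_).trans (hZμ.trans_le hTc)
      by_contra hxZ
      exact hx (hV x fun n h => hxZ (h.elim (fun h => hFZ _ h) (fun h => hFZ _ h)))
    exact ⟨U, K, ⟨hU, hUU, hsupp U hUD⟩, ⟨hK, hKK, hsupp K hKD⟩, Aut.mk_eq_mk.2 h⟩
  -- `S 0` and `S 2` have the same factors except for the first one of `S 0`, which is `T`.
  have hshift : S 0 = T * S 2 := by
    refine Bij.ext fun x => ?_
    rw [Bij.mul_apply]
    have hT0 : ∀ n, ∀ y ∈ F n, n ≠ 0 → T y = y := fun n y hy hn =>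
      (t 0).2.2 y (Set.disjoint_left.1 (hFd hn) hy)
    by_cases hx : ∀ n, x ∉ F (2 * n + 0)
    · rw [(hSp 0).2 x hx, (hSp 2).2 x fun n => hx (n + 1)]
      exact ((t 0).2.2 x (hx 0)).symm
    · push Not at hx
      obtain ⟨n, hn⟩ := hx
      rcases n with _ | n
      · rw [(hSp 0).1 0 x hn, (hSp 2).2 x fun n => Set.disjoint_left.1 (hFd (by lia)) hn]
        rfl
      · rw [(hSp 0).1 _ x hn, (hSp 2).1 n x hn]
        refine (hT0 (2 * n + 2) _ ?_ (by lia)).symm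
        exact (Bij.apply_mem_iff (t (2 * n + 2)).2.2 x).2 hn
  obtain ⟨U, K, hU, hK, h0⟩ := hmain 0
  obtain ⟨V, L, hV, hL, h1⟩ := hmain 1
  -- From Sᵢ = U K Sᵢ₊₁ K one gets Sᵢ Sᵢ₊₁⁻¹ = U K (Sᵢ₊₁ K Sᵢ₊₁⁻¹), for i = 0 and likewise for i = 1
  -- with `V` and `L`.
  refine ⟨U, K, S 1 * K * (S 1)⁻¹, V, L, S 2 * L * (S 2)⁻¹, hU, hK, hK.conj (hS 1), hV, hL,
    hL.conj (hS 2), ?_⟩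
  rw [hshift] at h0
  have m : ∀ A B : Bij μ, Aut.mk (A * B) = Aut.mk A * Aut.mk B := fun _ _ => rfl
  have mi : ∀ A : Bij μ, Aut.mk A⁻¹ = (Aut.mk A)⁻¹ := fun _ => rfl
  simp only [m, mi, zero_add, Nat.reduceAdd] at h0 h1 ⊢
  have h2 := eq_mul_inv_of_mul_eq h0
  have h3 : Aut.mk V * (Aut.mk L * (Aut.mk (S 2) * Aut.mk L)) * (Aut.mk (S 1))⁻¹ = 1 := by
    rw [← h1, mul_inv_cancel]
  rw [h2]
  calc _ = Aut.mk U * (Aut.mk K * (Aut.mk (S 1) * Aut.mk K)) * (Aut.mk (S 1))⁻¹ * Aut.mk (S 1) *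
        (Aut.mk (S 2))⁻¹ := by group
    _ = _ := by
      conv_lhs => enter [1, 2]; rw [h1]
      group

end Products

/-! ### Conjugation-invariant neighborhoods -/

section SIN

variable {X : Type*} [MeasurableSpace X] {μ : Measure X}

theorem uniformDist_mul_left (S T R : Aut μ) : uniformDist (S * T) (S * R) = uniformDist T R := by
  obtain ⟨S, rfl⟩ := Aut.mk_surjective S
  obtain ⟨T, rfl⟩ := Aut.mk_surjective T
  obtain ⟨R, rfl⟩ := Aut.mk_surjective R
  change μ.real {x | S (T x) ≠ S (R x)} = μ.real {x | T x ≠ R x}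
  simp only [S.injective.ne_iff]

theorem uniformDist_one_right (T : Bij μ) : uniformDist (Aut.mk T) 1 = μ.real T.supp := rfl

/-- If `V` is invariant under conjugation and contains `T`, then any involution whose support is
small compared to that of `T` is a quotient of two elements of `V`. -/
theorem exists_eq_div_of_conj_invariant [StandardBorelSpace X] [IsProbabilityMeasure μ]
    [NullSingletonClass μ] {G : Subgroup (Aut μ)} (hfull : IsFull G) (herg : IsErgodic G)
    {V : Set G} (hV : ∀ g : G, ∀ v ∈ V, g * v * g⁻¹ ∈ V) {T : Bij μ} (hT : T ∈ lift G)
    (hTV : (⟨Aut.mk T, hT⟩ : G) ∈ V) {c : ℝ} (hc : 3 * c ≤ 2 * μ.real T.supp) {U : Bij μ}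
    (hU : IsSmallInvolution G c U) :
    ∃ v ∈ V, ∃ w ∈ V, (⟨Aut.mk U, hU.mem⟩ : G) = v / w := by
  obtain ⟨R, hR, hinv, hsupp⟩ := exists_commutator_involution hfull herg T
    (r := μ.real U.supp) measureReal_nonneg (by linarith [hU.supp_le])
  obtain ⟨S, hS, hconj⟩ := exists_conj_involution hfull herg
    (mul_mem hT (mul_mem (mul_mem hR (inv_mem hT)) (inv_mem hR))) hU.mem hinv hU.apply_apply hsupp
  have h : Aut.mk S * (Aut.mk T * (Aut.mk R * (Aut.mk T)⁻¹ * (Aut.mk R)⁻¹)) =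
      Aut.mk U * Aut.mk S := Aut.mk_eq_mk.2 hconj
  -- `U` is the conjugate by `S` of T · (R T R⁻¹)⁻¹, so it is the quotient of the conjugates of `T`
  -- by `S` and by `S * R`.
  refine ⟨_, hV ⟨Aut.mk S, hS⟩ _ hTV, _, hV (⟨Aut.mk S, hS⟩ * ⟨Aut.mk R, hR⟩) _ hTV, ?_⟩
  refine Subtype.ext ?_
  change Aut.mk U = (Aut.mk S * Aut.mk T * (Aut.mk S)⁻¹) /
    (Aut.mk S * Aut.mk R * Aut.mk T * (Aut.mk S * Aut.mk R)⁻¹)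
  rw [eq_mul_inv_of_mul_eq h.symm, div_eq_mul_inv]
  group

theorem exists_conj_invariant_nhds {G : Subgroup (Aut μ)} [TopologicalSpace G]
    [IsTopologicalGroup G] (hSIN : IsSIN G) {O : Set G} (hO : O ∈ 𝓝 (1 : G)) : ∃ V ∈ 𝓝 (1 : G),
      (∀ g : G, ∀ v ∈ V, g * v * g⁻¹ ∈ V) ∧ ∀ v ∈ V, ∀ w ∈ V, v / w ∈ O := by
  obtain ⟨W, hW, hWO⟩ := exists_nhds_split_inv hO
  obtain ⟨V, ⟨hV, hVc⟩, hVW⟩ := HasBasis.mem_iff hSIN |>.1 hW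
  exact ⟨V, hV, hVc, fun v hv w hw => hWO v (hVW hv) w (hVW hw)⟩

variable [StandardBorelSpace X] [IsProbabilityMeasure μ] [NullSingletonClass μ]
  {G : Subgroup (Aut μ)}

/-- A Hausdorff SIN topology refines the uniform topology. -/
theorem uniform_ball_mem_nhds_one (hfull : IsFull G) (herg : IsErgodic G) [TopologicalSpace G]
    [IsTopologicalGroup G] [T2Space G] (hSIN : IsSIN G) {ε : ℝ} (hε : 0 < ε) :
    {g : G | uniformDist (g : Aut μ) 1 < ε} ∈ 𝓝 (1 : G) := by
  by_contra hnot
  -- The bound 2ε/3 makes `U` small relative to every element with support of measure at least ε.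
  obtain ⟨U, hU, hUU, -, hUμ⟩ := exists_involution_in hfull herg (A := Set.univ)
    MeasurableSet.univ (r := min (2 * ε / 3) 1) (by positivity) (by simp)
  have hUs : IsSmallInvolution G (2 * ε / 3) U := ⟨hU, hUU, hUμ.trans_le (min_le_left _ _)⟩
  have hmem : ∀ O ∈ 𝓝 (1 : G), (⟨Aut.mk U, hU⟩ : G) ∈ O := by
    intro O hO
    obtain ⟨V, hV, hVc, hVO⟩ := exists_conj_invariant_nhds hSIN hO
    obtain ⟨g, hgV, hg⟩ := Set.not_subset.1 fun h => hnot (mem_of_superset hV h)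
    obtain ⟨g, hgG⟩ := g
    obtain ⟨T, rfl⟩ := Aut.mk_surjective g
    simp only [Set.mem_ofPred_eq, uniformDist_one_right, not_lt] at hg
    obtain ⟨v, hv, w, hw, h⟩ := exists_eq_div_of_conj_invariant hfull herg hVc hgG hgV
      (c := 2 * ε / 3) (by linarith) hUs
    rw [h]
    exact hVO v hv w hw
  have h1 : (⟨Aut.mk U, hU⟩ : G) = 1 := by
    by_contra hne
    exact hmem _ (isOpen_compl_singleton.mem_nhds (Ne.symm hne)) rfl
  have h2 : μ.real U.supp = 0 := by
    rw [← uniformDist_one_right, show Aut.mk U = 1 from congrArg Subtype.val h1]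
    exact (uniformMetric μ).dist_self 1
  rw [hUμ] at h2
  have : 0 < min (2 * ε / 3) 1 := by positivity
  linarith

/-- A nondiscrete SIN topology is refined by the uniform topology. -/
theorem exists_uniform_ball_subset (hfull : IsFull G) (herg : IsErgodic G) [TopologicalSpace G]
    [IsTopologicalGroup G] (hSIN : IsSIN G) (hnd : {(1 : G)} ∉ 𝓝 (1 : G)) {O : Set G}
    (hO : O ∈ 𝓝 (1 : G)) :
    ∃ δ > 0, ∀ g : G, uniformDist (g : Aut μ) 1 < δ → g ∈ O := by
  -- Six factors from `Q` are grouped as 1 + 2 + 1 + 2, giving four elements of `P`.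
  obtain ⟨P, hP, hPO⟩ := exists_nhds_one_split4 hO
  obtain ⟨Q, hQ, hQP⟩ := exists_nhds_one_split hP
  obtain ⟨V, hV, hVc, hVQ⟩ := exists_conj_invariant_nhds hSIN hQ
  obtain ⟨g, hgV, hg⟩ := Set.not_subset.1 fun h => hnd (mem_of_superset hV h)
  obtain ⟨g, hgG⟩ := g
  obtain ⟨T, rfl⟩ := Aut.mk_surjective g
  have hTpos : 0 < μ.real T.supp := by
    refine lt_of_le_of_ne measureReal_nonneg fun h => hg ?_
    rw [← uniformDist_one_right] at h
    exact Subtype.ext ((uniformMetric μ).eq_of_dist_eq_zero h.symm)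
  set c := 2 * μ.real T.supp / 3 with hc
  have hsmall : ∀ U : Bij μ, ∀ hU : IsSmallInvolution G c U, (⟨Aut.mk U, hU.mem⟩ : G) ∈ Q := by
    intro U hU
    obtain ⟨v, hv, w, hw, h⟩ := exists_eq_div_of_conj_invariant hfull herg hVc hgG hgV
      (c := c) (by linarith) hU
    rw [h]
    exact hVQ v hv w hw
  have hQP' : ∀ q ∈ Q, q ∈ P := fun q hq => by
    simpa using hQP q hq 1 (mem_of_mem_nhds hQ)
  -- The involutions live in a set of three times the measure of the support: this must be at most
  -- `c` for smallness, and at most 1 to fit in `X`.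
  refine ⟨min (c / 3) (1 / 3), by positivity, fun g hg => ?_⟩
  obtain ⟨g, hgG⟩ := g
  obtain ⟨S, rfl⟩ := Aut.mk_surjective g
  rw [uniformDist_one_right, lt_min_iff] at hg
  obtain ⟨U₁, U₂, U₃, U₄, U₅, U₆, h₁, h₂, h₃, h₄, h₅, h₆, h⟩ := exists_eq_prod_involutions hfull
    herg hgG (c := c) (by linarith) (by linarith)
  have := hPO (hQP' _ (hsmall _ h₁)) (hQP _ (hsmall _ h₂) _ (hsmall _ h₃))
    (hQP' _ (hsmall _ h₄)) (hQP _ (hsmall _ h₅) _ (hsmall _ h₆))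
  convert this using 1
  exact Subtype.ext h

end SIN

end PMP

theorem theoremB {X : Type*} [MeasurableSpace X] [StandardBorelSpace X]
    (μ : MeasureTheory.Measure X) [MeasureTheory.IsProbabilityMeasure μ]
    [MeasureTheory.NullSingletonClass μ]
    (G : Subgroup (PMP.Aut μ)) (hfull : PMP.IsFull G) (herg : PMP.IsErgodic G)
    (τ : TopologicalSpace G) (hgrp : @IsTopologicalGroup G τ _) (hT2 : @T2Space G τ)
    (hSIN : @PMP.IsSIN G _ τ) :
    τ = ⊥ ∨ τ = PMP.uniformTopology G := by
  by_cases hd : {(1 : G)} ∈ 𝓝 (1 : G)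
  · left
    have : DiscreteTopology G := discreteTopology_of_isOpen_singleton_one
      (isOpen_singleton_iff_nhds_eq_pure _ |>.2
        (le_antisymm (le_pure_iff.2 hd) (pure_le_nhds _)))
    exact this.eq_bot
  · right
    have hbasis : ∀ g : G, (@nhds G (PMP.uniformTopology G) g).HasBasis (fun ε : ℝ => 0 < ε)
        fun ε => {h : G | PMP.uniformDist (h : PMP.Aut μ) g < ε} := by
      intro g
      let _ := PMP.uniformMetric μ
      rw [nhds_induced]
      exact Metric.nhds_basis_ball.comap _
    -- Both topologies are left-invariant, so the comparison at `g` reduces to the identity.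
    refine TopologicalSpace.ext_nhds fun g => le_antisymm ?_ ?_
    · rw [(hbasis g).ge_iff]
      intro ε hε
      rw [← map_mul_left_nhds_one g, mem_map]
      filter_upwards [PMP.uniform_ball_mem_nhds_one hfull herg hSIN hε] with k hk
      have := PMP.uniformDist_mul_left (g : PMP.Aut μ) k 1
      rw [mul_one] at this
      exact this.trans_lt hk
    · intro s hs
      rw [← map_mul_left_nhds_one g, mem_map] at hs
      obtain ⟨δ, hδ, h⟩ := PMP.exists_uniform_ball_subset hfull herg hSIN hd hs
      refine (hbasis g).mem_iff.2 ⟨δ, hδ, fun k hk => ?_⟩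
      have h1 := h (g⁻¹ * k) (by
        have := PMP.uniformDist_mul_left (g : PMP.Aut μ)⁻¹ k g
        rw [inv_mul_cancel] at this
        exact this.trans_lt hk)
      simpa using h1
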